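/- Let $d\in\mathbb N$, $\mathbb T=\mathbb R/2\pi\mathbb Z$, and let $V\in C^\infty(\mathbb R^d\times\mathbb T^d;\mathbb R)$ be bounded together with all its partial derivatives. For $\varepsilon>0$ put $$H(p,q)=H_0(p)+\varepsilon V(p,q),\qquad H_0(p)=\sum_{j=1}^d \frac{p_j^2}{2}.$$ For $0<\delta<\frac12$, $0<\beta<1$ and $\varepsilon>0$, a function $Z:\mathbb R^d\times\mathbb T^d\to\mathbb R$ is said to be in normal form (with parameters $\delta,\beta$, at $\varepsilon$) if $$Z(p,q)=\sum_{k\in\mathbb Z^d,\ |k|\le K}\hat Z_k(p)\,e^{i k\cdot q},\qquad K=\lfloor \varepsilon^{-\beta}\rfloor+1,$$ where, for every $k\neq0$, $\hat Z_k(p)\ne 0$ implies $|p\cdot k|\le\varepsilon^{\delta}$. Here $|\cdot|$ is the Euclidean norm. Fix $0<b<\frac12$. Then there exist $\delta\in(0,\frac12)$ and $\beta\in(0,1)$, depending only on $d$ and $b$, such that for every real $M>0$ there exist $C_M,\varepsilon_M>0$ with the following property. For every $0<\varepsilon<\varepsilon_M$ there exist a canonical transformation $(p,q)=\mathcal T(\tilde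 p,\tilde q)$ of $\mathbb R^d\times\mathbb T^d$ (a $C^\infty$ diffeomorphism preserving $\sum_j dp_j\wedge dq_j$) and a Hamiltonian $H_Z=H_0+Z$, with $Z\in C^\infty(\mathbb R^d\times\mathbb T^d)$ in normal form with parameters $\delta,\beta$ at $\varepsilon$, such that 1. $|p-\tilde p|\le C_M\varepsilon^{b}$ for all $(\tilde p,\tilde q)\in\mathbb R^d\times\mathbb T^d$; 2. $\|H\circ\mathcal T-H_Z\|_{C^2(\mathbb R^d\times\mathbb T^d)}\le C_M\varepsilon^{M}$; 3. all solutions of the Hamilton equations of $H_Z$ exist for all times, and along each of them $|\tilde p(t)-\tilde p(0)|\le C_M\varepsilon^{b}$ for all $t\in\mathbb R$. -/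

import Mathlib

open scoped ContDiff

noncomputable section

namespace Nekhoroshev

/-- `ℝ^d` with its Euclidean norm. -/
abbrev Vec (d : ℕ) : Type := EuclideanSpace ℝ (Fin d)

/-- The universal cover of the phase space `ℝ^d × 𝕋^d`, `𝕋 = ℝ / 2πℤ`. A point is a pair `(p, q)`
with `p` the actions and `q` the angles; objects on `ℝ^d × 𝕋^d` are objects on the cover that are
compatible with the translations of `q` by `2πℤ^d`. -/
abbrev Phase (d : ℕ) : Type := Vec d × Vec d

/-- The vector `2πk`. -/
def latticeVec {d : ℕ} (k : Fin d → ℤ) : Vec d :=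
  WithLp.toLp 2 fun i => 2 * Real.pi * (k i : ℝ)

/-- The scalar product `k · v` of an integer vector with a real vector. -/
def dotInt {d : ℕ} (k : Fin d → ℤ) (v : Vec d) : ℝ := ∑ i, (k i : ℝ) * v i

/-- `f` descends to a function on `ℝ^d × 𝕋^d`. -/
def AnglePeriodic {d : ℕ} (f : Phase d → ℝ) : Prop :=
  ∀ (p q : Vec d) (k : Fin d → ℤ), f (p, q + latticeVec k) = f (p, q)

/-- `f` is bounded together with all its derivatives. -/
def BoundedDerivs {d : ℕ} (f : Phase d → ℝ) : Prop :=
  ∀ n : ℕ, ∃ C : ℝ, ∀ x, ‖iteratedFDeriv ℝ n f x‖ ≤ C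

/-- `sup_x ‖D^n f(x)‖ ≤ A` for `n = 0, 1, 2`. -/
def C2NormLE {d : ℕ} (f : Phase d → ℝ) (A : ℝ) : Prop :=
  ∀ n : ℕ, n ≤ 2 → ∀ x, ‖iteratedFDeriv ℝ n f x‖ ≤ A

/-- `H₀(p) = ∑ p_j² / 2`. -/
def freeH {d : ℕ} (x : Phase d) : ℝ := ∑ j, x.1 j ^ 2 / 2

/-- `H = H₀ + ε V`. -/
def perturbedH {d : ℕ} (ε : ℝ) (V : Phase d → ℝ) (x : Phase d) : ℝ := freeH x + ε * V x

/-- The standard symplectic form `∑ dp_j ∧ dq_j`. -/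
def symplForm {d : ℕ} (u v : Phase d) : ℝ := inner ℝ u.1 v.2 - inner ℝ u.2 v.1

/-- `T` is (the lift of) a canonical transformation of `ℝ^d × 𝕋^d`: a smooth diffeomorphism,
compatible with the translations of the angles, that preserves the symplectic form. -/
structure IsCanonical {d : ℕ} (T : Phase d → Phase d) : Prop where
  smooth : ContDiff ℝ ∞ T
  equivariant : ∀ (p q : Vec d) (k : Fin d → ℤ),
    T (p, q + latticeVec k) = T (p, q) + (0, latticeVec k)
  smooth_inverse : ∃ S : Phase d → Phase d,
    ContDiff ℝ ∞ S ∧ Function.LeftInverse S T ∧ Function.RightInverse S T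
  symplectic : ∀ x u v : Phase d,
    symplForm (fderiv ℝ T x u) (fderiv ℝ T x v) = symplForm u v

/-- The Hamiltonian vector field `(ṗ, q̇) = (-∂H/∂q, ∂H/∂p)`. -/
def hamField {d : ℕ} (H : Phase d → ℝ) (x : Phase d) : Phase d :=
  (-gradient (fun q => H (x.1, q)) x.2, gradient (fun p => H (p, x.2)) x.1)

/-- `γ` solves the Hamilton equations of `H` for all times. -/
def IsSolution {d : ℕ} (H : Phase d → ℝ) (γ : ℝ → Phase d) : Prop :=
  ∀ t : ℝ, HasDerivAt γ (hamField H (γ t)) t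

/-- The Fourier cutoff `K(ε) = ⌊ε^{-β}⌋ + 1`. -/
def cutoff (β ε : ℝ) : ℕ := ⌊1 / ε ^ β⌋₊ + 1

/-- The integer vectors of Euclidean length at most `K`. -/
def modes (d K : ℕ) : Finset (Fin d → ℤ) :=
  (Fintype.piFinset fun _ => Finset.Icc (-(K : ℤ)) K).filter fun k => ∑ i, k i ^ 2 ≤ (K : ℤ) ^ 2

/-- `Z` is in normal form with parameters `δ, β` at `ε`: it is a trigonometric polynomial in the
angles with frequencies `|k| ≤ K(ε)`, and for `k ≠ 0` its `k`-th Fourier coefficient `c k` is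
supported in the resonant region `|p · k| ≤ ε^δ`. -/
def IsNormalForm {d : ℕ} (δ β ε : ℝ) (Z : Phase d → ℝ) : Prop :=
  ∃ c : (Fin d → ℤ) → Vec d → ℂ,
    (∀ p q : Vec d, (Z (p, q) : ℂ) =
      ∑ k ∈ modes d (cutoff β ε), c k p * Complex.exp (Complex.I * (dotInt k q : ℂ))) ∧
    ∀ k ∈ modes d (cutoff β ε), k ≠ 0 → ∀ p : Vec d, c k p ≠ 0 → |dotInt k p| ≤ ε ^ δ

end Nekhoroshev

end

/-!
Scaling the actions by `ε ^ δ` turns the resonance width `ε ^ δ` into `1` and the perturbation into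
one of size `μ = ε ^ (1 - 2δ)`. The canonical transformation with generating function `S` brings the
Hamiltonian to the form `H₀ + Z` up to the defect of `(S, Z)` in a Hamilton–Jacobi equation. The
linear part of this equation is solved by Fourier series in the angles, with smooth cutoffs in the
actions: the modes `k` with `|p · k|` away from `0` go into `S`, the others into `Z`, and those with
`|k| > K` are dropped. Each iteration improves the defect by a factor `μ`, and the dropped modes
contribute `O(K ^ (-N))` for every `N`.

A Hamiltonian in normal form moves `p` only along the integer vectors `k` that resonate with `p`.
The zone of a space `M` spanned by integer vectors consists of the `p` whose projection to `M` is
small, with a width that grows geometrically with `dim M`. Near the zone of `M`, and away from the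
zones of higher dimension, `p` moves along `M` only; to leave, it would have to cross a collar in
which it meets only resonances of smaller dimension, and by induction on the dimension it cannot
move far enough for that.
-/

noncomputable section

namespace Nekhoroshev

open scoped NNReal

/-! ### Integer vectors and their Gram matrices -/

section Gram

open Matrix

variable {E ι : Type*} [NormedAddCommGroup E] [InnerProductSpace ℝ E] [Fintype ι] {v : ι → E}

lemma gram_mulVec_apply (c : ι → ℝ) (i : ι) :
    (gram ℝ v *ᵥ c) i = inner ℝ (v i) (∑ j, c j • v j) := by
  simp [mulVec, dotProduct, inner_sum, inner_smul_right, mul_comm]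

variable [DecidableEq ι]

lemma det_gram_mul_eq (c : ι → ℝ) (i : ι) :
    (gram ℝ v).det * c i =
      ∑ j, (gram ℝ v).adjugate i j * inner ℝ (v j) (∑ l, c l • v l) := by
  have hcramer : (gram ℝ v).adjugate *ᵥ (gram ℝ v *ᵥ c) = (gram ℝ v).det • c := by
    rw [mulVec_mulVec, adjugate_mul, smul_mulVec, one_mulVec]
  simpa only [Pi.smul_apply, smul_eq_mul, mulVec, dotProduct, ← gram_mulVec_apply]
    using (congrFun hcramer i).symm

lemma abs_adjugate_gram_le {K : ℝ} (hK : 1 ≤ K) (hv : ∀ i, ‖v i‖ ≤ K) (i j : ι) :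
    |(gram ℝ v).adjugate i j| ≤ (Fintype.card ι).factorial * (K ^ 2) ^ Fintype.card ι := by
  have hK2 : 1 ≤ K ^ 2 := one_le_pow₀ hK
  have hentry : ∀ a b, |(gram ℝ v).updateRow j (Pi.single i 1) a b| ≤ K ^ 2 := by
    intro a b
    rw [updateRow_apply]
    split_ifs
    · rcases eq_or_ne b i with rfl | hb
      · simpa using hK2
      · simpa [Pi.single_eq_of_ne hb] using sq_nonneg K
    · rw [gram_apply, sq]
      exact (abs_real_inner_le_norm _ _).trans
        (mul_le_mul (hv a) (hv b) (norm_nonneg _) (zero_le_one.trans hK))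
  rw [adjugate_apply]
  simpa using det_le (abv := AbsoluteValue.abs) hentry

lemma abs_coeff_le_of_one_le_abs_det_gram {K : ℝ} (hK : 1 ≤ K) (hv : ∀ i, ‖v i‖ ≤ K)
    (hdet : 1 ≤ |(gram ℝ v).det|) (c : ι → ℝ) (i : ι) :
    |c i| ≤ Fintype.card ι * ((Fintype.card ι).factorial * (K ^ 2) ^ Fintype.card ι) * K *
      ‖∑ j, c j • v j‖ := by
  set w := ∑ j, c j • v j
  calc |c i| ≤ |(gram ℝ v).det| * |c i| := le_mul_of_one_le_left (abs_nonneg _) hdet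
    _ = |∑ j, (gram ℝ v).adjugate i j * inner ℝ (v j) w| := by rw [← abs_mul, det_gram_mul_eq]
    _ ≤ ∑ j, |(gram ℝ v).adjugate i j| * |inner ℝ (v j) w| :=
        (Finset.abs_sum_le_sum_abs _ _).trans_eq (by simp only [abs_mul])
    _ ≤ ∑ _j : ι, ((Fintype.card ι).factorial * (K ^ 2) ^ Fintype.card ι) * (K * ‖w‖) := by
        gcongr with j
        · exact abs_adjugate_gram_le hK hv i j
        · exact (abs_real_inner_le_norm _ _).trans (by gcongr; exact hv j)
    _ = _ := by rw [Finset.sum_const, Finset.card_univ, nsmul_eq_mul]; ring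

end Gram

/-- The integer vector `k`, seen as a vector of `ℝ^d`. -/
def intVec {d : ℕ} (k : Fin d → ℤ) : Vec d := WithLp.toLp 2 fun i => (k i : ℝ)

section IntegerVectors

variable {d K : ℕ}

lemma inner_intVec (k : Fin d → ℤ) (v : Vec d) : inner ℝ (intVec k) v = dotInt k v := by
  simp [intVec, dotInt, PiLp.inner_apply, mul_comm]

lemma inner_intVec_intVec (k l : Fin d → ℤ) :
    inner ℝ (intVec k) (intVec l) = ((∑ i, k i * l i : ℤ) : ℝ) := by
  rw [inner_intVec]
  simp [dotInt, intVec]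

lemma mem_modes_iff {k : Fin d → ℤ} : k ∈ modes d K ↔ ‖intVec k‖ ≤ K := by
  have hnorm : ‖intVec k‖ ≤ K ↔ ∑ i, k i ^ 2 ≤ (K : ℤ) ^ 2 := by
    rw [← sq_le_sq₀ (norm_nonneg _) K.cast_nonneg, EuclideanSpace.real_norm_sq_eq]
    simp only [intVec]
    exact_mod_cast Iff.rfl
  rw [hnorm, modes, Finset.mem_filter, and_iff_right_iff_imp, Fintype.mem_piFinset]
  intro h i
  rw [Finset.mem_Icc, ← abs_le]
  refine abs_le_of_sq_le_sq ?_ K.cast_nonneg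
  exact (Finset.single_le_sum (f := fun i => k i ^ 2) (fun i _ => sq_nonneg _)
    (Finset.mem_univ i)).trans h

lemma norm_intVec_le {k : Fin d → ℤ} (hk : k ∈ modes d K) : ‖intVec k‖ ≤ K :=
  mem_modes_iff.1 hk

lemma one_le_abs_det_gram_intVec {ι : Type*} [Fintype ι] [DecidableEq ι] {k : ι → Fin d → ℤ}
    (hli : LinearIndependent ℝ fun i => intVec (k i)) :
    1 ≤ |(Matrix.gram ℝ fun i => intVec (k i)).det| := by
  let G : Matrix ι ι ℤ := Matrix.of fun i j => ∑ l, k i l * k j l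
  have hG : Matrix.gram ℝ (fun i => intVec (k i)) = (Int.castRingHom ℝ).mapMatrix G := by
    ext i j
    exact inner_intVec_intVec (k i) (k j)
  have hdet := Matrix.det_gram_ne_zero_iff_linearIndependent.2 hli
  rw [hG, ← RingHom.map_det, eq_intCast] at hdet ⊢
  exact_mod_cast Int.one_le_abs (Int.cast_ne_zero.1 hdet)

end IntegerVectors

/-! ### Geometry of resonances -/

section StarProjection

variable {E : Type*} [NormedAddCommGroup E] [InnerProductSpace ℝ E] {M : Submodule ℝ E}

lemma inner_starProjection_eq_of_mem [M.HasOrthogonalProjection] {v : E} (hv : v ∈ M) (p : E) :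
    inner ℝ (M.starProjection p) v = inner ℝ p v := by
  rw [Submodule.inner_starProjection_left_eq_right, Submodule.starProjection_eq_self_iff.2 hv]

lemma norm_starProjection_sup_span_le {k p : E} [M.HasOrthogonalProjection]
    [(M ⊔ Submodule.span ℝ {k}).HasOrthogonalProjection] {A L σ x : ℝ} (hA : 0 ≤ A) (hk : ‖k‖ ≤ L)
    (hcoeff : ∀ m ∈ M, ∀ c : ℝ, |c| ≤ A * ‖m + c • k‖) (hσ : ‖M.starProjection p‖ ≤ σ)
    (hx : |inner ℝ p k| ≤ x) :
    ‖(M ⊔ Submodule.span ℝ {k}).starProjection p‖ ≤ (1 + A * L) * σ + A * x := by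
  have hσ0 : 0 ≤ σ := (norm_nonneg _).trans hσ
  have hx0 : 0 ≤ x := (abs_nonneg _).trans hx
  have hL0 : 0 ≤ L := (norm_nonneg _).trans hk
  obtain ⟨m, hm, y, hy, hmy⟩ := Submodule.mem_sup.1
    (Submodule.starProjection_apply_mem (M ⊔ Submodule.span ℝ {k}) p)
  obtain ⟨c, rfl⟩ := Submodule.mem_span_singleton.1 hy
  set v := (M ⊔ Submodule.span ℝ {k}).starProjection p
  have hc : |c| ≤ A * ‖v‖ := hmy ▸ hcoeff m hm c
  have hmv : ‖m‖ ≤ (1 + A * L) * ‖v‖ := by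
    calc ‖m‖ = ‖v - c • k‖ := by rw [← hmy, add_sub_cancel_right]
      _ ≤ ‖v‖ + |c| * ‖k‖ := (norm_sub_le _ _).trans_eq (by rw [norm_smul, Real.norm_eq_abs])
      _ ≤ ‖v‖ + A * ‖v‖ * L := by gcongr
      _ = _ := by ring
  have hself : ‖v‖ * ‖v‖ ≤ ‖v‖ * ((1 + A * L) * σ + A * x) := by
    calc ‖v‖ * ‖v‖ = inner ℝ p v := by
          rw [← real_inner_self_eq_norm_mul_norm]
          exact inner_starProjection_eq_of_mem (Submodule.starProjection_apply_mem _ p) p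
      _ = inner ℝ (M.starProjection p) m + c * inner ℝ p k := by
          rw [← hmy, inner_add_right, inner_smul_right, inner_starProjection_eq_of_mem hm]
      _ ≤ ‖M.starProjection p‖ * ‖m‖ + |c| * |inner ℝ p k| :=
          add_le_add (real_inner_le_norm _ _) ((le_abs_self _).trans_eq (abs_mul _ _))
      _ ≤ σ * ((1 + A * L) * ‖v‖) + A * ‖v‖ * x := by gcongr
      _ = _ := by ring
  rcases (norm_nonneg v).eq_or_lt with hv0 | hv0
  · rw [← hv0]; positivity
  · exact le_of_mul_le_mul_left hself hv0

lemma sub_mem_of_deriv_mem [M.HasOrthogonalProjection] {p p' : ℝ → E} {a b : ℝ} (hab : a ≤ b)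
    (hp : ∀ t, HasDerivAt p (p' t) t) (hM : ∀ t ∈ Set.Icc a b, p' t ∈ M) : p b - p a ∈ M := by
  rw [← Submodule.orthogonal_orthogonal M, Submodule.mem_orthogonal']
  intro v hv
  have hderiv : ∀ t, HasDerivAt (fun t => inner ℝ (p t) v) (inner ℝ (p' t) v) t := fun t => by
    simpa using (hp t).inner ℝ (hasDerivAt_const t v)
  rw [inner_sub_left, sub_eq_zero]
  refine constant_of_has_deriv_right_zero (f := fun t => inner ℝ (p t) v)
    (fun t _ => (hderiv t).continuousAt.continuousWithinAt) (fun t ht => ?_) b ⟨hab, le_rfl⟩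
  rw [← Submodule.inner_right_of_mem_orthogonal (hM t ⟨ht.1, ht.2.le⟩) hv]
  exact (hderiv t).hasDerivWithinAt

end StarProjection

section Crossing

variable {f : ℝ → ℝ} {a b u v : ℝ}

lemma exists_crossing (hf : ContinuousOn f (Set.Icc a b)) (hab : a ≤ b)
    (ha : f a ≤ u) (huv : u < v) (hb : v ≤ f b) :
    ∃ s t, a ≤ s ∧ s ≤ t ∧ t ≤ b ∧ f s = u ∧ f t = v ∧
      ∀ x ∈ Set.Icc s t, u ≤ f x ∧ f x ≤ v := by
  -- `t` is the first time at which `f` takes the value `v`, and `s` the last time before `t` at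
  -- which it takes the value `u`.
  obtain ⟨t, ⟨ht, hft⟩, hfirst⟩ : ∃ t, IsLeast {x ∈ Set.Icc a b | f x = v} t :=
    (isCompact_Icc.of_isClosed_subset (hf.preimage_isClosed_of_isClosed isClosed_Icc
      isClosed_singleton) fun x hx => hx.1).exists_isLeast
      (intermediate_value_Icc hab hf ⟨ha.trans huv.le, hb⟩)
  have hft' : ContinuousOn f (Set.Icc a t) := hf.mono (Set.Icc_subset_Icc_right ht.2)
  obtain ⟨s, ⟨hs, hfs⟩, hlast⟩ : ∃ s, IsGreatest {x ∈ Set.Icc a t | f x = u} s :=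
    (isCompact_Icc.of_isClosed_subset (hft'.preimage_isClosed_of_isClosed isClosed_Icc
      isClosed_singleton) fun x hx => hx.1).exists_isGreatest
      (intermediate_value_Icc ht.1 hft' ⟨ha, huv.le.trans_eq hft.symm⟩)
  refine ⟨s, t, hs.1, hs.2, ht.2, hfs, hft, fun x hx => ⟨?_, ?_⟩⟩
  · by_contra! hlt
    obtain ⟨y, hy, hfy⟩ := intermediate_value_Icc hx.2
      (hft'.mono (Set.Icc_subset_Icc_left (hs.1.trans hx.1))) ⟨hlt.le, huv.le.trans_eq hft.symm⟩
    have hys : y ≤ s := hlast ⟨⟨hs.1.trans (hx.1.trans hy.1), hy.2⟩, hfy⟩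
    have hxs : x = s := le_antisymm (hy.1.trans hys) hx.1
    exact hlt.ne (hxs ▸ hfs)
  · by_contra! hlt
    have hax : a ≤ x := hs.1.trans hx.1
    obtain ⟨y, hy, hfy⟩ := intermediate_value_Icc hax
      (hft'.mono (Set.Icc_subset_Icc_right hx.2)) ⟨ha.trans huv.le, hlt.le⟩
    have hty : t ≤ y := hfirst ⟨⟨hy.1, hy.2.trans (hx.2.trans ht.2)⟩, hfy⟩
    have hxt : x = t := le_antisymm hx.2 (hty.trans hy.2)
    exact hlt.ne' (hxt ▸ hft)

lemma lt_of_small_oscillation (hf : Continuous f) (huv : u < v) {t₀ : ℝ} (ht₀ : t₀ ∈ Set.Icc a b)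
    (hu : f t₀ ≤ u)
    (hosc : ∀ s t, a ≤ s → s ≤ t → t ≤ b → (∀ x ∈ Set.Icc s t, u ≤ f x ∧ f x ≤ v) →
      |f t - f s| < v - u) :
    ∀ t ∈ Set.Icc a b, f t < v := by
  intro t ht
  by_contra! hlt
  rcases le_total t₀ t with h | h
  · obtain ⟨x, y, hx, hxy, hy, hfx, hfy, hmid⟩ := exists_crossing hf.continuousOn h hu huv hlt
    have hxy' := hosc x y (ht₀.1.trans hx) hxy (hy.trans ht.2) hmid
    exact (le_abs_self _).not_gt (hfx ▸ hfy ▸ hxy')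
  · obtain ⟨x, y, hx, hxy, hy, hfx, hfy, hmid⟩ := exists_crossing (f := fun t => f (-t))
      (hf.comp continuous_neg).continuousOn (neg_le_neg h) (by simpa using hu) huv (by simpa)
    have hyx := hosc (-y) (-x) (ht.1.trans (le_neg_of_le_neg hy)) (neg_le_neg hxy)
      ((neg_le.1 hx).trans ht₀.2) fun z hz => by
        simpa using hmid (-z) ⟨le_neg_of_le_neg hz.2, neg_le.1 hz.1⟩
    rw [hfx, hfy, abs_sub_comm] at hyx
    exact (le_abs_self _).not_gt hyx

end Crossing

section IntegerSpans

variable {d K : ℕ} {M : Submodule ℝ (Vec d)}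

/-- `M` is a resonance module of order `K`: it is spanned by integer vectors of length at most
`K`. -/
def IsIntSpan (K : ℕ) (M : Submodule ℝ (Vec d)) : Prop :=
  ∃ S : Set (Fin d → ℤ), S ⊆ modes d K ∧ M = Submodule.span ℝ (intVec '' S)

lemma isIntSpan_bot : IsIntSpan K (⊥ : Submodule ℝ (Vec d)) := ⟨∅, by simp, by simp⟩

lemma IsIntSpan.sup_span (hM : IsIntSpan K M) {k : Fin d → ℤ} (hk : k ∈ modes d K) :
    IsIntSpan K (M ⊔ Submodule.span ℝ {intVec k}) := by
  obtain ⟨S, hS, rfl⟩ := hM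
  refine ⟨S ∪ {k}, Set.union_subset hS (Set.singleton_subset_iff.2 hk), ?_⟩
  rw [Set.image_union, Set.image_singleton, Submodule.span_union]

/-- The constant in the lower bound for the distance between an integer vector and a resonance
module of order `K` that does not contain it. -/
def sepConst (d K : ℕ) : ℝ := d * (d.factorial * ((K : ℝ) ^ 2) ^ d) * K

lemma sepConst_nonneg (d K : ℕ) : 0 ≤ sepConst d K := by
  rw [sepConst]; positivity

lemma card_mul_le_sepConst (hK : 1 ≤ K) {n : ℕ} (hn : n ≤ d) :
    n * (n.factorial * ((K : ℝ) ^ 2) ^ n) * K ≤ sepConst d K := by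
  have hK' : (1 : ℝ) ≤ K := Nat.one_le_cast.2 hK
  have hfact : n.factorial ≤ d.factorial := Nat.factorial_le hn
  have hpow : ((K : ℝ) ^ 2) ^ n ≤ ((K : ℝ) ^ 2) ^ d := pow_le_pow_right₀ (one_le_pow₀ hK') hn
  rw [sepConst]
  gcongr

/-- The Gram determinant of linearly independent integer vectors is at least `1` in absolute value,
so Cramer's rule bounds the coefficients of their combinations. -/
lemma IsIntSpan.abs_coeff_le (hK : 1 ≤ K) (hM : IsIntSpan K M) {k : Fin d → ℤ}
    (hk : k ∈ modes d K) (hkM : intVec k ∉ M) {m : Vec d} (hm : m ∈ M) (c : ℝ) :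
    |c| ≤ sepConst d K * ‖m + c • intVec k‖ := by
  classical
  obtain ⟨S, hS, rfl⟩ := hM
  obtain ⟨κ, l, -, hspan, hli⟩ := exists_linearIndependent' ℝ fun l : S => intVec (l : Fin d → ℤ)
  have : Fintype κ := @Fintype.ofFinite κ hli.finite
  rw [show Set.range (fun l : S => intVec (l : Fin d → ℤ)) = intVec '' S from
    (Set.image_eq_range _ _).symm] at hspan
  let k' : Option κ → Fin d → ℤ := fun o => o.elim k fun j => l j
  have hk' : ∀ o, k' o ∈ modes d K := by
    rintro (_ | j)
    exacts [hk, hS (l j).2]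
  have hli' : LinearIndependent ℝ fun o => intVec (k' o) := by
    refine linearIndependent_option.2 ⟨hli, ?_⟩
    change intVec k ∉ Submodule.span ℝ (Set.range ((fun l : S => intVec (l : Fin d → ℤ)) ∘ l))
    rwa [hspan]
  have hcard : Fintype.card (Option κ) ≤ d := by simpa using hli'.fintype_card_le_finrank
  rw [← hspan] at hm
  obtain ⟨e, rfl⟩ := (Submodule.mem_span_range_iff_exists_fun ℝ).1 hm
  have hbound := abs_coeff_le_of_one_le_abs_det_gram (Nat.one_le_cast.2 hK)
    (fun o => norm_intVec_le (hk' o)) (one_le_abs_det_gram_intVec hli') (fun o => o.elim c e) none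
  rw [Fintype.sum_option, add_comm] at hbound
  exact hbound.trans
    (mul_le_mul_of_nonneg_right (card_mul_le_sepConst hK hcard) (norm_nonneg _))

lemma IsIntSpan.norm_starProjection_sup_le (hK : 1 ≤ K) (hM : IsIntSpan K M) {k : Fin d → ℤ}
    (hk : k ∈ modes d K) (hkM : intVec k ∉ M) {p : Vec d} {σ x : ℝ}
    (hσ : ‖M.starProjection p‖ ≤ σ) (hx : |dotInt k p| ≤ x) :
    ‖(M ⊔ Submodule.span ℝ {intVec k}).starProjection p‖ ≤
      (1 + sepConst d K * K) * σ + sepConst d K * x :=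
  norm_starProjection_sup_span_le (sepConst_nonneg d K) (norm_intVec_le hk)
    (fun _ hm c => hM.abs_coeff_le hK hk hkM hm c) hσ
    (by rwa [real_inner_comm, inner_intVec])

end IntegerSpans

section Drift

variable {d K : ℕ} {r : ℝ}

/-- The width of the resonant zones of multiplicity `s`. -/
def zoneWidth (d K : ℕ) (r : ℝ) (s : ℕ) : ℝ := (32 * (1 + sepConst d K * K)) ^ s * r

lemma one_le_zoneRatio (d K : ℕ) : 1 ≤ 32 * (1 + sepConst d K * K) := by
  linarith [mul_nonneg (sepConst_nonneg d K) K.cast_nonneg]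

lemma zoneWidth_succ (d K : ℕ) (r : ℝ) (s : ℕ) :
    zoneWidth d K r (s + 1) = 32 * (1 + sepConst d K * K) * zoneWidth d K r s := by
  rw [zoneWidth, zoneWidth, pow_succ]; ring

lemma zoneWidth_mono (hr : 0 ≤ r) : Monotone (zoneWidth d K r) := fun _ _ hst =>
  mul_le_mul_of_nonneg_right (pow_le_pow_right₀ (one_le_zoneRatio d K) hst) hr

lemma le_zoneWidth (hr : 0 ≤ r) (s : ℕ) : r ≤ zoneWidth d K r s :=
  le_mul_of_one_le_left hr (one_le_pow₀ (one_le_zoneRatio d K))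

lemma zoneWidth_pos (hr : 0 < r) (s : ℕ) : 0 < zoneWidth d K r s :=
  hr.trans_le (le_zoneWidth hr.le s)

lemma mul_zoneWidth_le_succ (hr : 0 ≤ r) (s : ℕ) :
    32 * zoneWidth d K r s ≤ zoneWidth d K r (s + 1) := by
  have hw : 0 ≤ zoneWidth d K r s := hr.trans (le_zoneWidth hr s)
  rw [zoneWidth_succ]
  linarith [mul_nonneg (mul_nonneg (sepConst_nonneg d K) K.cast_nonneg) hw]

/-- The point `p` lies in no resonant zone of multiplicity larger than `s`. -/
def NonresonantAbove (K : ℕ) (r : ℝ) (s : ℕ) (p : Vec d) : Prop :=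
  ∀ M : Submodule ℝ (Vec d), IsIntSpan K M → s < Module.finrank ℝ M →
    zoneWidth d K r (Module.finrank ℝ M) < ‖M.starProjection p‖

/-- The directions in which a Hamiltonian in normal form can move the action `p`: the span of the
frequencies of length at most `K` that are resonant at `p` up to `r`. -/
def resonantSpan (K : ℕ) (r : ℝ) (p : Vec d) : Submodule ℝ (Vec d) :=
  Submodule.span ℝ (intVec '' {k | k ∈ modes d K ∧ |dotInt k p| ≤ r})

lemma nonresonantAbove_dim (K : ℕ) (r : ℝ) (p : Vec d) : NonresonantAbove K r d p := by
  intro M _ hM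
  have hle := M.finrank_le
  rw [finrank_euclideanSpace_fin] at hle
  exact absurd hM hle.not_gt

variable {p : Vec d} {M : Submodule ℝ (Vec d)}

lemma IsIntSpan.intVec_mem (hK : 1 ≤ K) (hr : 0 < r) (hM : IsIntSpan K M)
    (hp : NonresonantAbove K r (Module.finrank ℝ M) p)
    (hpM : ‖M.starProjection p‖ ≤ 2 * zoneWidth d K r (Module.finrank ℝ M)) {k : Fin d → ℤ}
    (hk : k ∈ modes d K) (hkp : |dotInt k p| ≤ K * zoneWidth d K r (Module.finrank ℝ M)) :
    intVec k ∈ M := by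
  by_contra hkM
  have hlt : Module.finrank ℝ M < Module.finrank ℝ ↥(M ⊔ Submodule.span ℝ {intVec k}) :=
    Submodule.finrank_lt_finrank_of_lt <| left_lt_sup.2 fun hle =>
      hkM (hle (Submodule.mem_span_singleton_self _))
  have hnear := hM.norm_starProjection_sup_le hK hk hkM hpM hkp
  have hfar := (zoneWidth_mono hr.le (Nat.succ_le_of_lt hlt)).trans_lt
    (hp _ (hM.sup_span hk) hlt)
  rw [Nat.succ_eq_add_one, zoneWidth_succ] at hfar
  have hw := zoneWidth_pos (d := d) (K := K) hr (Module.finrank ℝ M)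
  linarith [mul_nonneg (mul_nonneg (sepConst_nonneg d K) K.cast_nonneg) hw.le]

lemma IsIntSpan.resonantSpan_le (hK : 1 ≤ K) (hr : 0 < r) (hM : IsIntSpan K M)
    (hp : NonresonantAbove K r (Module.finrank ℝ M) p)
    (hpM : ‖M.starProjection p‖ ≤ 2 * zoneWidth d K r (Module.finrank ℝ M)) :
    resonantSpan K r p ≤ M := by
  rw [resonantSpan, Submodule.span_le]
  rintro _ ⟨k, ⟨hk, hkr⟩, rfl⟩
  have hw : r ≤ zoneWidth d K r (Module.finrank ℝ M) := le_zoneWidth hr.le _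
  exact hM.intVec_mem hK hr hp hpM hk
    (hkr.trans (hw.trans (le_mul_of_one_le_left (hr.le.trans hw) (Nat.one_le_cast.2 hK))))

lemma IsIntSpan.le_of_norm_starProjection_le (hK : 1 ≤ K) (hr : 0 < r) (hM : IsIntSpan K M)
    (hp : NonresonantAbove K r (Module.finrank ℝ M) p)
    (hpM : ‖M.starProjection p‖ ≤ 2 * zoneWidth d K r (Module.finrank ℝ M))
    {N : Submodule ℝ (Vec d)} (hN : IsIntSpan K N)
    (hpN : ‖N.starProjection p‖ ≤ zoneWidth d K r (Module.finrank ℝ M)) : N ≤ M := by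
  obtain ⟨S, hS, rfl⟩ := hN
  rw [Submodule.span_le]
  rintro _ ⟨k, hk, rfl⟩
  refine hM.intVec_mem hK hr hp hpM (hS hk) ?_
  rw [← inner_intVec, real_inner_comm, ← inner_starProjection_eq_of_mem
    (Submodule.subset_span (Set.mem_image_of_mem intVec hk)), mul_comm]
  refine (abs_real_inner_le_norm _ _).trans ?_
  exact mul_le_mul hpN (norm_intVec_le (hS hk)) (norm_nonneg _) (zoneWidth_pos hr _).le

lemma NonresonantAbove.of_lt_norm_starProjection (hK : 1 ≤ K) (hr : 0 < r) {s : ℕ}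
    (hp : NonresonantAbove K r (s + 1) p) (hM : IsIntSpan K M) (hMs : Module.finrank ℝ M = s + 1)
    (hlt : zoneWidth d K r (s + 1) < ‖M.starProjection p‖)
    (hle : ‖M.starProjection p‖ ≤ 2 * zoneWidth d K r (s + 1)) : NonresonantAbove K r s p := by
  intro N hN hNs
  rcases (Nat.succ_le_of_lt hNs).lt_or_eq with h | h
  · exact hp N hN h
  rw [← h]
  by_contra! hpN
  have hNM : N ≤ M := by
    rw [← hMs] at hp hle
    exact hM.le_of_norm_starProjection_le hK hr hp hle hN (by rwa [hMs])
  obtain rfl : N = M := Submodule.eq_of_le_of_finrank_eq hNM (h.symm.trans hMs.symm)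
  exact hpN.not_gt hlt

lemma NonresonantAbove.of_forall_finrank_eq {s : ℕ} (hp : NonresonantAbove K r (s + 1) p)
    (h : ∀ M : Submodule ℝ (Vec d), IsIntSpan K M → Module.finrank ℝ M = s + 1 →
      zoneWidth d K r (s + 1) < ‖M.starProjection p‖) : NonresonantAbove K r s p := by
  intro M hM hs
  rcases (Nat.succ_le_of_lt hs).lt_or_eq with hlt | heq
  · exact hp M hM hlt
  · exact heq ▸ h M hM heq.symm

section Curve

variable {p p' : ℝ → Vec d} {a b : ℝ}

/-- A curve that enters the zone of a resonance module `M` can only move along `M` while it stays in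
the doubled zone; between the zone and the doubled zone it meets only resonances of smaller
multiplicity, so it moves too little to leave. -/
lemma norm_sub_le_of_mem_zone (hK : 1 ≤ K) (hr : 0 < r) (hp : ∀ t, HasDerivAt p (p' t) t)
    (hdrift : ∀ t, p' t ∈ resonantSpan K r (p t)) {s : ℕ}
    (hlower : ∀ x y, x ≤ y → (∀ t ∈ Set.Icc x y, NonresonantAbove K r s (p t)) →
      ‖p y - p x‖ ≤ 4 * zoneWidth d K r s)
    (hab : a ≤ b) (hres : ∀ t ∈ Set.Icc a b, NonresonantAbove K r (s + 1) (p t))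
    (hM : IsIntSpan K M) (hMs : Module.finrank ℝ M = s + 1) {t₀ : ℝ} (ht₀ : t₀ ∈ Set.Icc a b)
    (hMw : ‖M.starProjection (p t₀)‖ ≤ zoneWidth d K r (s + 1)) :
    ‖p b - p a‖ ≤ 4 * zoneWidth d K r (s + 1) := by
  have hw0 := zoneWidth_pos (d := d) (K := K) hr (s + 1)
  have hws := mul_zoneWidth_le_succ (d := d) (K := K) hr.le s
  have hcont : Continuous p := continuous_iff_continuousAt.2 fun t => (hp t).continuousAt
  set w := zoneWidth d K r (s + 1) with hw
  have hosc : ∀ x y, a ≤ x → x ≤ y → y ≤ b →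
      (∀ t ∈ Set.Icc x y, 5 / 4 * w ≤ ‖M.starProjection (p t)‖ ∧
        ‖M.starProjection (p t)‖ ≤ 3 / 2 * w) →
      |‖M.starProjection (p y)‖ - ‖M.starProjection (p x)‖| < 3 / 2 * w - 5 / 4 * w := by
    intro x y hx hxy hy hmid
    have hmove : ‖p y - p x‖ ≤ 4 * zoneWidth d K r s := hlower x y hxy fun t ht =>
      (hres t ⟨hx.trans ht.1, ht.2.trans hy⟩).of_lt_norm_starProjection hK hr hM hMs
        (by linarith [hmid t ht]) (by linarith [hmid t ht])
    have hproj := (abs_norm_sub_norm_le (M.starProjection (p y)) (M.starProjection (p x))).trans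
      (map_sub M.starProjection (p y) (p x) ▸ M.norm_starProjection_apply_le _)
    linarith
  have htrap : ∀ t ∈ Set.Icc a b, ‖M.starProjection (p t)‖ < 3 / 2 * w :=
    lt_of_small_oscillation (M.starProjection.continuous.comp hcont).norm (by linarith) ht₀
      (hMw.trans (by linarith)) hosc
  have hmem : p b - p a ∈ M := sub_mem_of_deriv_mem hab hp fun t ht =>
    hM.resonantSpan_le hK hr (by rw [hMs]; exact hres t ht)
      (by rw [hMs, ← hw]; linarith [htrap t ht]) (hdrift t)
  rw [← Submodule.starProjection_eq_self_iff.2 hmem, map_sub]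
  linarith [norm_sub_le (M.starProjection (p b)) (M.starProjection (p a)),
    htrap a ⟨le_rfl, hab⟩, htrap b ⟨hab, le_rfl⟩]

lemma norm_sub_le_zoneWidth (hK : 1 ≤ K) (hr : 0 < r) (hp : ∀ t, HasDerivAt p (p' t) t)
    (hdrift : ∀ t, p' t ∈ resonantSpan K r (p t)) {s : ℕ} (hab : a ≤ b)
    (hres : ∀ t ∈ Set.Icc a b, NonresonantAbove K r s (p t)) :
    ‖p b - p a‖ ≤ 4 * zoneWidth d K r s := by
  induction s generalizing a b with
  | zero =>
    have hmem : p b - p a ∈ (⊥ : Submodule ℝ (Vec d)) := by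
      refine sub_mem_of_deriv_mem hab hp fun t ht => ?_
      refine isIntSpan_bot.resonantSpan_le hK hr (by simpa using hres t ht) ?_ (hdrift t)
      simpa using (zoneWidth_pos hr _).le
    rw [(Submodule.mem_bot ℝ).1 hmem, norm_zero]
    linarith [zoneWidth_pos (d := d) (K := K) hr 0]
  | succ s ih =>
    by_cases hzone : ∃ t ∈ Set.Icc a b, ∃ M : Submodule ℝ (Vec d), IsIntSpan K M ∧
        Module.finrank ℝ M = s + 1 ∧ ‖M.starProjection (p t)‖ ≤ zoneWidth d K r (s + 1)
    · obtain ⟨t₀, ht₀, M, hM, hMs, hMw⟩ := hzone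
      exact norm_sub_le_of_mem_zone hK hr hp hdrift (fun _ _ => ih) hab hres hM hMs ht₀ hMw
    · push Not at hzone
      have hmono : zoneWidth d K r s ≤ zoneWidth d K r (s + 1) := zoneWidth_mono hr.le s.le_succ
      refine (ih hab fun t ht => ?_).trans (by linarith)
      exact (hres t ht).of_forall_finrank_eq (hzone t ht)

end Curve

lemma zoneWidth_dim_le (hK : 1 ≤ K) (hr : 0 ≤ r) :
    zoneWidth d K r d ≤ (32 * (1 + d * d.factorial)) ^ d * (K : ℝ) ^ ((2 * d + 2) * d) * r := by
  have hK' : (1 : ℝ) ≤ (K : ℝ) ^ (2 * d + 2) := one_le_pow₀ (Nat.one_le_cast.2 hK)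
  have hratio : 1 + sepConst d K * K ≤ (1 + d * d.factorial) * (K : ℝ) ^ (2 * d + 2) := by
    have hsep : sepConst d K * K = d * d.factorial * (K : ℝ) ^ (2 * d + 2) := by
      rw [sepConst, ← pow_mul]; ring
    linarith
  have h0 := sepConst_nonneg d K
  rw [zoneWidth, pow_mul, ← mul_pow, mul_assoc 32]
  gcongr

lemma exists_drift_bound (d : ℕ) : ∃ C : ℝ, 0 < C ∧ ∀ (K : ℕ), 1 ≤ K → ∀ r : ℝ, 0 < r →
    ∀ p p' : ℝ → Vec d, (∀ t, HasDerivAt p (p' t) t) → (∀ t, p' t ∈ resonantSpan K r (p t)) →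
    ∀ t, ‖p t - p 0‖ ≤ C * (K : ℝ) ^ ((2 * d + 2) * d) * r := by
  refine ⟨4 * (32 * (1 + d * d.factorial)) ^ d, by positivity, fun K hK r hr p p' hp hdrift t => ?_⟩
  suffices ‖p t - p 0‖ ≤ 4 * zoneWidth d K r d by
    linarith [zoneWidth_dim_le (d := d) hK hr.le]
  rcases le_total 0 t with h | h
  · exact norm_sub_le_zoneWidth hK hr hp hdrift h fun _ _ => nonresonantAbove_dim K r _
  · rw [norm_sub_rev]
    exact norm_sub_le_zoneWidth hK hr hp hdrift h fun _ _ => nonresonantAbove_dim K r _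

end Drift

/-! ### Families of smooth functions with uniformly bounded derivatives -/


section SmoothBigO

universe u

variable {ι : Type*} {X F G E : Type*} [NormedAddCommGroup X] [NormedSpace ℝ X]
  [NormedAddCommGroup F] [NormedSpace ℝ F] [NormedAddCommGroup G] [NormedSpace ℝ G]
  [NormedAddCommGroup E] [NormedSpace ℝ E]

/-- The `n`-th derivatives of the functions `f i` are `O(η i)`, uniformly in `i`. -/
def DerivBigO (n : ℕ) (f : ι → X → F) (η : ι → ℝ≥0) : Prop :=
  ∃ C : ℝ≥0, ∀ i x, ‖iteratedFDeriv ℝ n (f i) x‖ ≤ C * η i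

/-- The functions `f i` are smooth and all their derivatives are `O(η i)`, with constants that
depend on the order of the derivative but not on `i`. -/
structure SmoothBigO (f : ι → X → F) (η : ι → ℝ≥0) : Prop where
  smooth : ∀ i, ContDiff ℝ ∞ (f i)
  bound : ∀ n, DerivBigO n f η

lemma derivBigO_succ_iff {n : ℕ} {f : ι → X → F} {η : ι → ℝ≥0} :
    DerivBigO (n + 1) f η ↔ DerivBigO n (fun i => fderiv ℝ (f i)) η := by
  simp only [DerivBigO, norm_iteratedFDeriv_fderiv]

lemma DerivBigO.bilin {n : ℕ} {f : ι → X → F} {g : ι → X → G} {η θ : ι → ℝ≥0}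
    (B : F →L[ℝ] G →L[ℝ] E) (hfs : ∀ i, ContDiff ℝ ∞ (f i)) (hgs : ∀ i, ContDiff ℝ ∞ (g i))
    (hf : ∀ m ≤ n, DerivBigO m f η) (hg : ∀ m ≤ n, DerivBigO m g θ) :
    DerivBigO n (fun i x => B (f i x) (g i x)) (η * θ) := by
  choose! C hC using hf
  choose! D hD using hg
  refine ⟨‖B‖₊ * ∑ m ∈ Finset.range (n + 1), (n.choose m : ℝ≥0) * C m * D (n - m), fun i x => ?_⟩
  refine (B.norm_iteratedFDeriv_le_of_bilinear (hfs i) (hgs i) x (n := n)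
    (by exact_mod_cast le_top)).trans ?_
  push_cast
  rw [mul_assoc, Finset.sum_mul]
  refine mul_le_mul_of_nonneg_left (Finset.sum_le_sum fun m hm => ?_) (norm_nonneg B)
  calc (n.choose m : ℝ) * ‖iteratedFDeriv ℝ m (f i) x‖ * ‖iteratedFDeriv ℝ (n - m) (g i) x‖
      ≤ n.choose m * (C m * η i) * (D (n - m) * θ i) := by
        gcongr
        · exact hC m (Finset.mem_range_succ_iff.1 hm) i x
        · exact hD (n - m) (Nat.sub_le _ _) i x
    _ = _ := by simp only [Pi.mul_apply, NNReal.coe_mul]; ring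

lemma DerivBigO.add {n : ℕ} {f g : ι → X → F} {η : ι → ℝ≥0}
    (hfs : ∀ i, ContDiff ℝ ∞ (f i)) (hgs : ∀ i, ContDiff ℝ ∞ (g i))
    (hf : DerivBigO n f η) (hg : DerivBigO n g η) : DerivBigO n (fun i x => f i x + g i x) η := by
  obtain ⟨C, hC⟩ := hf
  obtain ⟨D, hD⟩ := hg
  refine ⟨C + D, fun i x => ?_⟩
  rw [show iteratedFDeriv ℝ n (fun x => f i x + g i x) x =
      iteratedFDeriv ℝ n (f i) x + iteratedFDeriv ℝ n (g i) x from
    iteratedFDeriv_add_apply ((hfs i).contDiffAt.of_le (by exact_mod_cast le_top))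
      ((hgs i).contDiffAt.of_le (by exact_mod_cast le_top)), NNReal.coe_add, add_mul]
  exact (norm_add_le _ _).trans (add_le_add (hC i x) (hD i x))

namespace SmoothBigO

variable {f : ι → X → F} {g : ι → X → G} {η θ : ι → ℝ≥0}

lemma bilin (B : F →L[ℝ] G →L[ℝ] E) (hf : SmoothBigO f η) (hg : SmoothBigO g θ) :
    SmoothBigO (fun i x => B (f i x) (g i x)) (η * θ) where
  smooth i := B.isBoundedBilinearMap.contDiff.comp ((hf.smooth i).prodMk (hg.smooth i))
  bound _ := DerivBigO.bilin B hf.smooth hg.smooth (fun m _ => hf.bound m) fun m _ => hg.bound m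

lemma add {g : ι → X → F} (hf : SmoothBigO f η) (hg : SmoothBigO g η) :
    SmoothBigO (fun i x => f i x + g i x) η where
  smooth i := (hf.smooth i).add (hg.smooth i)
  bound n := (hf.bound n).add hf.smooth hg.smooth (hg.bound n)

lemma clm (L : F →L[ℝ] G) (hf : SmoothBigO f η) : SmoothBigO (fun i x => L (f i x)) η where
  smooth i := L.contDiff.comp (hf.smooth i)
  bound n := by
    obtain ⟨C, hC⟩ := hf.bound n
    refine ⟨‖L‖₊ * C, fun i x => ?_⟩
    calc _ ≤ ‖L‖ * ‖iteratedFDeriv ℝ n (f i) x‖ :=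
          L.norm_iteratedFDeriv_comp_left (hf.smooth i).contDiffAt (by exact_mod_cast le_top)
      _ ≤ ‖L‖ * (C * η i) := by gcongr; exact hC i x
      _ = _ := by push_cast; ring

lemma neg (hf : SmoothBigO f η) : SmoothBigO (fun i x => -f i x) η := by
  simpa using hf.clm (-ContinuousLinearMap.id ℝ F)

lemma sub {g : ι → X → F} (hf : SmoothBigO f η) (hg : SmoothBigO g η) :
    SmoothBigO (fun i x => f i x - g i x) η := by
  simpa only [sub_eq_add_neg] using hf.add hg.neg

lemma mono (hf : SmoothBigO f η) {c : ℝ≥0} (h : ∀ i, η i ≤ c * θ i) : SmoothBigO f θ where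
  smooth := hf.smooth
  bound n := by
    obtain ⟨C, hC⟩ := hf.bound n
    refine ⟨C * c, fun i x => (hC i x).trans ?_⟩
    rw [NNReal.coe_mul, mul_assoc]
    gcongr
    exact_mod_cast h i

lemma mono_le (hf : SmoothBigO f η) (h : η ≤ θ) : SmoothBigO f θ :=
  hf.mono (c := 1) fun i => (h i).trans_eq (one_mul _).symm

lemma index_smul (hf : SmoothBigO f η) (c : ι → ℝ≥0) :
    SmoothBigO (fun i x => (c i : ℝ) • f i x) (c * η) where
  smooth i := (hf.smooth i).const_smul _
  bound n := by
    obtain ⟨C, hC⟩ := hf.bound n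
    refine ⟨C, fun i x => ?_⟩
    rw [show iteratedFDeriv ℝ n (fun x => (c i : ℝ) • f i x) x =
        (c i : ℝ) • iteratedFDeriv ℝ n (f i) x from
      iteratedFDeriv_const_smul_apply ((hf.smooth i).contDiffAt.of_le (by exact_mod_cast le_top))]
    calc ‖(c i : ℝ) • iteratedFDeriv ℝ n (f i) x‖ = c i * ‖iteratedFDeriv ℝ n (f i) x‖ := by
          rw [norm_smul, NNReal.norm_eq]
      _ ≤ c i * (C * η i) := by gcongr; exact hC i x
      _ = _ := by rw [Pi.mul_apply, NNReal.coe_mul]; ring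

lemma fderiv_right (hf : SmoothBigO f η) : SmoothBigO (fun i => fderiv ℝ (f i)) η where
  smooth i := (hf.smooth i).fderiv_right (by simp)
  bound n := derivBigO_succ_iff.1 (hf.bound (n + 1))

lemma const (c : F) : SmoothBigO (fun (_ : ι) (_ : X) => c) 1 where
  smooth _ := contDiff_const
  bound n := by
    rcases n with _ | n
    · exact ⟨‖c‖₊, fun i x => by simp⟩
    · exact ⟨0, fun i x => by simp [iteratedFDeriv_const_of_ne (𝕜 := ℝ) n.succ_ne_zero c]⟩

lemma norm_le (hf : SmoothBigO f η) : ∃ C : ℝ≥0, ∀ i x, ‖f i x‖ ≤ C * η i := by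
  simpa only [DerivBigO, norm_iteratedFDeriv_zero] using hf.bound 0

lemma norm_fderiv_le (hf : SmoothBigO f η) : ∃ C : ℝ≥0, ∀ i x, ‖fderiv ℝ (f i) x‖ ≤ C * η i :=
  hf.fderiv_right.norm_le

lemma exists_forall_le (hf : SmoothBigO f η) (m : ℕ) :
    ∃ C : ℝ≥0, ∀ n ≤ m, ∀ i x, ‖iteratedFDeriv ℝ n (f i) x‖ ≤ C * η i := by
  choose C hC using hf.bound
  refine ⟨∑ n ∈ Finset.range (m + 1), C n, fun n hn i x => (hC n i x).trans ?_⟩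
  gcongr
  exact Finset.single_le_sum (f := C) (fun _ _ => zero_le) (Finset.mem_range_succ_iff.2 hn)

lemma differentiable (hf : SmoothBigO f η) (i : ι) : Differentiable ℝ (f i) :=
  (hf.smooth i).differentiable (by simp)

variable {u : ι → X → X}

lemma id_add_fderiv (hu : SmoothBigO u 1) :
    SmoothBigO (fun i x => ContinuousLinearMap.id ℝ X + fderiv ℝ (u i) x) 1 :=
  (const _).add hu.fderiv_right

lemma derivBigO_id_add (hu : SmoothBigO u 1) (n : ℕ) :
    DerivBigO (n + 1) (fun i x => x + u i x) (1 : ι → ℝ≥0) := by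
  rw [derivBigO_succ_iff]
  have hderiv : (fun i => fderiv ℝ fun x => x + u i x) =
      fun i x => ContinuousLinearMap.id ℝ X + fderiv ℝ (u i) x := by
    funext i x
    exact ((hasFDerivAt_id x).add (hu.differentiable i x).hasFDerivAt).fderiv
  rw [hderiv]
  exact hu.id_add_fderiv.bound n

lemma comp_id_add (hf : SmoothBigO f η) (hu : SmoothBigO u 1) :
    SmoothBigO (fun i x => f i (x + u i x)) η where
  smooth i := (hf.smooth i).comp (contDiff_id.add (hu.smooth i))
  bound n := by
    choose C hC using hf.bound
    choose D hD using hu.derivBigO_id_add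
    let C' := ∑ m ∈ Finset.range (n + 1), C m
    let D' := 1 + ∑ m ∈ Finset.range n, D m
    have hC' : ∀ m ≤ n, C m ≤ C' := fun m hm =>
      Finset.single_le_sum (f := C) (fun _ _ => zero_le) (Finset.mem_range_succ_iff.2 hm)
    have hD' : ∀ m < n, D m ≤ D' ^ (m + 1) := fun m hm =>
      ((Finset.single_le_sum (f := D) (fun _ _ => zero_le) (Finset.mem_range.2 hm)).trans
        (le_add_of_nonneg_left zero_le)).trans
        (le_self_pow₀ (le_add_of_nonneg_right zero_le) m.succ_ne_zero)
    refine ⟨n.factorial * C' * D' ^ n, fun i x => ?_⟩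
    have hcomp := norm_iteratedFDeriv_comp_le (hf.smooth i) (contDiff_id.add (hu.smooth i))
      (n := n) (by exact_mod_cast le_top) x (C := C' * η i) (D := D') (fun m hm => ?_)
      fun m h1 hm => ?_
    · exact hcomp.trans_eq (by push_cast; ring)
    · refine (hC m i _).trans ?_
      gcongr
      exact hC' m hm
    · obtain ⟨l, rfl⟩ := Nat.exists_eq_add_of_le' h1
      have hl := hD l i x
      rw [Pi.one_apply, NNReal.coe_one, mul_one] at hl
      exact hl.trans (by exact_mod_cast hD' l hm)

end SmoothBigO

section CompSub

variable {η θ : ι → ℝ≥0}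

lemma hasFDerivAt_comp_id_add {f : X → F} {w : X → X} {x : X}
    (hf : DifferentiableAt ℝ f (x + w x)) (hw : DifferentiableAt ℝ w x) :
    HasFDerivAt (fun x => f (x + w x))
      ((fderiv ℝ f (x + w x)).comp (ContinuousLinearMap.id ℝ X + fderiv ℝ w x)) x :=
  hf.hasFDerivAt.comp x ((hasFDerivAt_id x).add hw.hasFDerivAt)

lemma fderiv_comp_id_add_sub {f : X → F} {u v : X → X} (hf : Differentiable ℝ f)
    (hu : Differentiable ℝ u) (hv : Differentiable ℝ v) (x : X) :
    fderiv ℝ (fun x => f (x + u x) - f (x + v x)) x =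
      ContinuousLinearMap.compL ℝ X X F (fderiv ℝ f (x + u x) - fderiv ℝ f (x + v x))
        (ContinuousLinearMap.id ℝ X + fderiv ℝ u x) +
      ContinuousLinearMap.compL ℝ X X F (fderiv ℝ f (x + v x))
        (fderiv ℝ (fun x => u x - v x) x) := by
  rw [((hasFDerivAt_comp_id_add (hf _) (hu x)).fun_sub
    (hasFDerivAt_comp_id_add (hf _) (hv x))).fderiv, fderiv_fun_sub (hu x) (hv x)]
  ext y
  simp only [ContinuousLinearMap.compL_apply, add_apply, sub_apply, map_add, map_sub,
    ContinuousLinearMap.comp_apply, ContinuousLinearMap.id_apply]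
  abel

variable {X F : Type u} [NormedAddCommGroup X] [NormedSpace ℝ X] [NormedAddCommGroup F]
  [NormedSpace ℝ F] {f : ι → X → F} {u v : ι → X → X}

lemma derivBigO_comp_sub (hu : SmoothBigO u 1) (hv : SmoothBigO v 1)
    (huv : SmoothBigO (fun i x => u i x - v i x) θ) (hf : SmoothBigO f η) (n : ℕ) :
    DerivBigO n (fun i x => f i (x + u i x) - f i (x + v i x)) (η * θ) := by
  induction n using Nat.strong_induction_on generalizing F with
  | _ n ih =>
    rcases n with _ | n
    · obtain ⟨C, hC⟩ := hf.norm_fderiv_le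
      obtain ⟨D, hD⟩ := huv.norm_le
      refine ⟨C * D, fun i x => ?_⟩
      rw [norm_iteratedFDeriv_zero]
      calc ‖f i (x + u i x) - f i (x + v i x)‖
          ≤ C * η i * ‖x + u i x - (x + v i x)‖ :=
            convex_univ.norm_image_sub_le_of_norm_fderiv_le (𝕜 := ℝ)
              (fun y _ => hf.differentiable i y) (fun y _ => hC i y) (Set.mem_univ _)
              (Set.mem_univ _)
        _ = C * η i * ‖u i x - v i x‖ := by rw [add_sub_add_left_eq_sub]
        _ ≤ C * η i * (D * θ i) := by gcongr; exact hD i x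
        _ = ↑(C * D) * ↑((η * θ) i) := by rw [Pi.mul_apply]; push_cast; ring
    · have hfd := hf.fderiv_right
      have hfirst := DerivBigO.bilin (n := n) (ContinuousLinearMap.compL ℝ X X F)
        (fun i => ((hfd.comp_id_add hu).smooth i).sub ((hfd.comp_id_add hv).smooth i))
        hu.id_add_fderiv.smooth (fun m hm => ih m (Nat.lt_succ_of_le hm) hfd)
        (fun m _ => hu.id_add_fderiv.bound m)
      have hsecond := (hfd.comp_id_add hv).bilin (ContinuousLinearMap.compL ℝ X X F)
        huv.fderiv_right
      rw [mul_one] at hfirst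
      rw [derivBigO_succ_iff]
      simp only [funext (fderiv_comp_id_add_sub (hf.differentiable _) (hu.differentiable _)
        (hv.differentiable _))]
      let B := ContinuousLinearMap.compL ℝ X X F
      exact hfirst.add (fun i => B.isBoundedBilinearMap.contDiff.comp
        ((((hfd.comp_id_add hu).smooth i).sub ((hfd.comp_id_add hv).smooth i)).prodMk
          (hu.id_add_fderiv.smooth i))) hsecond.smooth (hsecond.bound n)

lemma SmoothBigO.comp_sub (hf : SmoothBigO f η) (hu : SmoothBigO u 1) (hv : SmoothBigO v 1)
    (huv : SmoothBigO (fun i x => u i x - v i x) θ) :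
    SmoothBigO (fun i x => f i (x + u i x) - f i (x + v i x)) (η * θ) where
  smooth i := ((hf.comp_id_add hu).smooth i).sub ((hf.comp_id_add hv).smooth i)
  bound n := derivBigO_comp_sub hu hv huv hf n

end CompSub

end SmoothBigO

/-! ### Fourier projections in the angles -/

section Fourier

open MeasureTheory UnitAddTorus

local instance : MeasureSpace UnitAddCircle := ⟨AddCircle.haarAddCircle⟩

local instance : Measure.IsAddHaarMeasure (volume : Measure UnitAddCircle) :=
  inferInstanceAs (Measure.IsAddHaarMeasure AddCircle.haarAddCircle)

variable {d : ℕ}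

/-- Periodicity in the angles, as in `AnglePeriodic`, for functions with values in any type. -/
def IsAnglePeriodic {E : Type*} (f : Phase d → E) : Prop :=
  ∀ (x : Phase d) (k : Fin d → ℤ), f (x + (0, latticeVec k)) = f x

/-- The translation of the angles by `2πy`. Angles are parametrized by `ℝ / ℤ` in this section, to
match the Fourier monomials `UnitAddTorus.mFourier`. -/
def angle (y : Fin d → ℝ) : Phase d := (0, WithLp.toLp 2 fun i => 2 * Real.pi * y i)

lemma angle_add (y z : Fin d → ℝ) : angle (y + z) = angle y + angle z := by
  ext i
  · simp [angle]
  · simp [angle, mul_add]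

lemma continuous_angle : Continuous (angle (d := d)) := by
  unfold angle
  fun_prop

lemma exists_angle_eq (v : Vec d) : ∃ s : Fin d → ℝ, angle s = (0, v) := by
  refine ⟨fun i => v i / (2 * Real.pi), Prod.ext rfl ?_⟩
  ext i
  simp only [angle]
  field_simp

/-- The quotient map from `ℝ^d` to the torus `(ℝ / ℤ)^d`. -/
def torusMk (y : Fin d → ℝ) : UnitAddTorus (Fin d) := fun i => (y i : UnitAddCircle)

lemma torusMk_add (y z : Fin d → ℝ) : torusMk (y + z) = torusMk y + torusMk z := by
  funext i
  simp [torusMk]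

lemma isOpenQuotientMap_torusMk : IsOpenQuotientMap (torusMk (d := d)) :=
  IsOpenQuotientMap.piMap fun _ => QuotientAddGroup.isOpenQuotientMap_mk

/-- The standard fundamental domain of the torus `(ℝ / ℤ)^d`. -/
def unitCube (d : ℕ) : Set (Fin d → ℝ) := Set.univ.pi fun _ => Set.Ioc 0 1

lemma volume_unitCube : (volume : Measure (Fin d → ℝ)) (unitCube d) = 1 := by
  rw [unitCube, volume_pi_pi]
  simp

local instance : IsProbabilityMeasure ((volume : Measure (Fin d → ℝ)).restrict (unitCube d)) :=
  ⟨by rw [Measure.restrict_apply_univ, volume_unitCube]⟩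

lemma norm_mFourier_apply (k : Fin d → ℤ) (τ : UnitAddTorus (Fin d)) : ‖mFourier k τ‖ = 1 := by
  simp [mFourier, fourier_apply, Circle.norm_coe]

lemma mFourier_apply_add (k : Fin d → ℤ) (σ τ : UnitAddTorus (Fin d)) :
    mFourier k (σ + τ) = mFourier k σ * mFourier k τ := by
  simp only [mFourier, ContinuousMap.coe_mk, ← Finset.prod_mul_distrib]
  refine Finset.prod_congr rfl fun i _ => ?_
  simp [fourier_apply, AddCircle.toCircle_add]

lemma mFourier_neg_apply_neg (k : Fin d → ℤ) (τ : UnitAddTorus (Fin d)) :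
    mFourier (-k) (-τ) = mFourier k τ := by
  simp only [mFourier, ContinuousMap.coe_mk]
  refine Finset.prod_congr rfl fun i _ => ?_
  simp [fourier_apply]

lemma mFourier_torusMk (k : Fin d → ℤ) (y : Fin d → ℝ) :
    mFourier k (torusMk y) = Complex.exp (Complex.I * (dotInt k (angle y).2 : ℂ)) := by
  simp only [mFourier, ContinuousMap.coe_mk, torusMk, fourier_coe_apply, ← Complex.exp_sum]
  congr 1
  simp only [dotInt, angle, Complex.ofReal_sum, Finset.mul_sum]
  refine Finset.sum_congr rfl fun i _ => ?_
  push_cast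
  ring

section Projection

variable {E : Type*}

/-- The function on the torus induced by `f` on the angles around `x`. -/
def descend (f : Phase d → E) (x : Phase d) (τ : UnitAddTorus (Fin d)) : E :=
  f (x + angle fun i => (AddCircle.equivIoc 1 0 (τ i)).1)

lemma exists_equivIoc_coe_eq (y : ℝ) :
    ∃ n : ℤ, (AddCircle.equivIoc (1 : ℝ) 0 (y : UnitAddCircle)).1 = y + n := by
  have hmk : ((AddCircle.equivIoc (1 : ℝ) 0 (y : UnitAddCircle)).1 : UnitAddCircle) = y :=
    (AddCircle.equivIoc (1 : ℝ) 0).symm_apply_apply y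
  rw [QuotientAddGroup.eq, AddSubgroup.mem_zmultiples_iff] at hmk
  obtain ⟨n, hn⟩ := hmk
  refine ⟨-n, ?_⟩
  simp only [zsmul_eq_mul, mul_one] at hn
  push_cast
  linarith

lemma descend_torusMk {f : Phase d → E} (hf : IsAnglePeriodic f) (x : Phase d) (y : Fin d → ℝ) :
    descend f x (torusMk y) = f (x + angle y) := by
  choose n hn using fun i => exists_equivIoc_coe_eq (y i)
  rw [descend, ← hf (x + angle y) n, add_assoc]
  congr 2
  ext i
  · simp [angle]
  · simp [angle, latticeVec, torusMk, hn, mul_add]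

lemma descend_add_angle {f : Phase d → E} (hf : IsAnglePeriodic f) (x : Phase d) (s : Fin d → ℝ)
    (τ : UnitAddTorus (Fin d)) : descend f (x + angle s) τ = descend f x (τ + torusMk s) := by
  obtain ⟨y, rfl⟩ := isOpenQuotientMap_torusMk.surjective τ
  rw [← torusMk_add, descend_torusMk hf, descend_torusMk hf, add_comm y, angle_add, add_assoc]

lemma continuous_descend [TopologicalSpace E] {f : Phase d → E} (hf : IsAnglePeriodic f)
    (hc : Continuous f) (x : Phase d) : Continuous (descend f x) := by
  rw [← isOpenQuotientMap_torusMk.continuous_comp_iff,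
    show descend f x ∘ torusMk = fun y => f (x + angle y) from funext (descend_torusMk hf x)]
  exact hc.comp (continuous_const.add continuous_angle)

variable [NormedAddCommGroup E] [NormedSpace ℂ E]

lemma continuous_fproj_integrand (k : Fin d → ℤ) {f : Phase d → E} (hf : Continuous f)
    (x : Phase d) : Continuous fun y => mFourier (-k) (torusMk y) • f (x + angle y) :=
  ((mFourier (-k)).continuous.comp isOpenQuotientMap_torusMk.continuous).smul
    (hf.comp (continuous_const.add continuous_angle))

lemma integrableOn_fproj_integrand (k : Fin d → ℤ) {f : Phase d → E} (hf : Continuous f)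
    (x : Phase d) :
    IntegrableOn (fun y => mFourier (-k) (torusMk y) • f (x + angle y)) (unitCube d) :=
  ((continuous_fproj_integrand k hf x).continuousOn.integrableOn_compact
    (isCompact_Icc (a := (0 : Fin d → ℝ)) (b := 1))).mono_set fun _ hy =>
      ⟨fun i => (hy i trivial).1.le, fun i => (hy i trivial).2⟩

variable [NormedSpace ℝ E]

/-- The projection of `f` on the `k`-th Fourier mode in the angles; it includes the factor
`exp (i k · q)`, so that `f` is the sum of its projections. -/
def fproj (k : Fin d → ℤ) (f : Phase d → E) (x : Phase d) : E :=
  ∫ y in unitCube d, mFourier (-k) (torusMk y) • f (x + angle y)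

lemma norm_fproj_le (k : Fin d → ℤ) {f : Phase d → E} {C : ℝ} (hC : ∀ x, ‖f x‖ ≤ C)
    (x : Phase d) : ‖fproj k f x‖ ≤ C := by
  refine (norm_integral_le_of_norm_le_const (C := C) (.of_forall fun y => ?_)).trans (by simp)
  rw [norm_smul, norm_mFourier_apply, one_mul]
  exact hC _

lemma fproj_clm {E' : Type*} [NormedAddCommGroup E'] [NormedSpace ℝ E'] [NormedSpace ℂ E']
    [CompleteSpace E] [CompleteSpace E'] (L : E →L[ℝ] E')
    (hL : ∀ (c : ℂ) (e : E), L (c • e) = c • L e) (k : Fin d → ℤ) {f : Phase d → E}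
    (hf : Continuous f) (x : Phase d) :
    fproj k (fun x => L (f x)) x = L (fproj k f x) := by
  rw [fproj, fproj, ← L.integral_comp_comm (integrableOn_fproj_integrand k hf x)]
  simp only [hL]

lemma fproj_eq_integral_descend (k : Fin d → ℤ) {f : Phase d → E} (hf : IsAnglePeriodic f)
    (x : Phase d) :
    fproj k f x = ∫ τ : UnitAddTorus (Fin d), mFourier (-k) τ • descend f x τ := by
  have hcube : unitCube d =
      {y | ∀ i, y i ∈ Set.Ioc ((0 : Fin d → ℝ) i) ((0 : Fin d → ℝ) i + 1)} := by
    ext y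
    simp [unitCube]
  simp only [fproj, ← descend_torusMk hf, hcube]
  exact (integral_preimage (fun τ => mFourier (-k) τ • descend f x τ) 0).symm

lemma fproj_add_angle (k : Fin d → ℤ) {f : Phase d → E} (hf : IsAnglePeriodic f)
    (x : Phase d) (s : Fin d → ℝ) :
    fproj k f (x + angle s) = mFourier k (torusMk s) • fproj k f x := by
  calc fproj k f (x + angle s)
      = ∫ τ, mFourier (-k) (τ + torusMk s - torusMk s) • descend f x (τ + torusMk s) := by
        simp only [fproj_eq_integral_descend k hf, descend_add_angle hf, add_sub_cancel_right]
    _ = ∫ τ, mFourier (-k) (τ - torusMk s) • descend f x τ :=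
        integral_add_right_eq_self (fun τ => mFourier (-k) (τ - torusMk s) • descend f x τ) _
    _ = ∫ τ, mFourier k (torusMk s) • mFourier (-k) τ • descend f x τ := by
        simp only [sub_eq_add_neg, mFourier_apply_add, mFourier_neg_apply_neg, smul_smul, mul_comm]
    _ = mFourier k (torusMk s) • fproj k f x := by
        rw [integral_smul, ← fproj_eq_integral_descend k hf]

lemma fproj_add (k : Fin d → ℤ) {f : Phase d → E} (hf : IsAnglePeriodic f)
    (x : Phase d) (v : Vec d) :
    fproj k f (x + (0, v)) = Complex.exp (Complex.I * (dotInt k v : ℂ)) • fproj k f x := by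
  obtain ⟨s, hs⟩ := exists_angle_eq v
  rw [← hs, fproj_add_angle k hf, mFourier_torusMk, hs]

variable [IsScalarTower ℝ ℂ E]

lemma hasFDerivAt_fproj (k : Fin d → ℤ) {f : Phase d → E} (hf : ContDiff ℝ 1 f) {C : ℝ}
    (hC : ∀ x, ‖fderiv ℝ f x‖ ≤ C) (x : Phase d) :
    HasFDerivAt (fproj k f) (fproj k (fderiv ℝ f) x) x := by
  refine hasFDerivAt_integral_of_dominated_of_fderiv_le (bound := fun _ => C)
    (F' := fun x y => mFourier (-k) (torusMk y) • fderiv ℝ f (x + angle y)) Filter.univ_mem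
    (.of_forall fun x => (continuous_fproj_integrand k hf.continuous x).aestronglyMeasurable)
    (integrableOn_fproj_integrand k hf.continuous x)
    (continuous_fproj_integrand k (hf.continuous_fderiv one_ne_zero) x).aestronglyMeasurable
    (.of_forall fun y z _ => ?_) (integrable_const _) (.of_forall fun y z _ => ?_)
  · rw [norm_smul, norm_mFourier_apply, one_mul]
    exact hC _
  · have hshift : HasFDerivAt (fun z => f (z + angle y)) (fderiv ℝ f (z + angle y)) z := by
      rw [hasFDerivAt_comp_add_right]
      exact (hf.differentiable one_ne_zero _).hasFDerivAt
    exact hshift.const_smul (mFourier (-k) (torusMk y))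

lemma fproj_fderiv_apply (k : Fin d → ℤ) {f : Phase d → E} (hp : IsAnglePeriodic f)
    (hf : ContDiff ℝ 1 f) {C : ℝ} (hC : ∀ x, ‖fderiv ℝ f x‖ ≤ C) (x : Phase d) (v : Vec d) :
    fproj k (fderiv ℝ f) x (0, v) = (Complex.I * (dotInt k v : ℂ)) • fproj k f x := by
  have hline : HasDerivAt (fun t : ℝ => fproj k f (x + t • (0, v)))
      (fproj k (fderiv ℝ f) x (0, v)) 0 := by
    have hx : HasFDerivAt (fproj k f) (fproj k (fderiv ℝ f) x)
        (x + (0 : ℝ) • ((0 : Vec d), v)) := by simpa using hasFDerivAt_fproj k hf hC x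
    have hmove : HasDerivAt (fun t : ℝ => x + t • ((0 : Vec d), v)) (0, v) 0 := by
      simpa using ((hasDerivAt_id (0 : ℝ)).smul_const ((0 : Vec d), v)).const_add x
    exact hx.comp_hasDerivAt (0 : ℝ) hmove
  have hexp : HasDerivAt (fun t : ℝ => Complex.exp (Complex.I * (dotInt k v : ℂ) * t))
      (Complex.I * (dotInt k v : ℂ)) 0 := by
    simpa using ((hasDerivAt_id (0 : ℝ)).ofReal_comp.const_mul
      (Complex.I * (dotInt k v : ℂ))).cexp
  have hmode : (fun t : ℝ => fproj k f (x + t • (0, v))) =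
      fun t : ℝ => Complex.exp (Complex.I * (dotInt k v : ℂ) * t) • fproj k f x := by
    funext t
    rw [Prod.smul_mk, smul_zero, fproj_add k hp, ← inner_intVec, ← inner_intVec,
      inner_smul_right, Complex.ofReal_mul, mul_comm (t : ℂ), mul_assoc]
  rw [hmode] at hline
  exact hline.unique (hexp.smul_const _)

end Projection

end Fourier

section FourierDecay

open MeasureTheory UnitAddTorus

variable {d : ℕ}

lemma IsAnglePeriodic.fderiv_right {F : Type*} [NormedAddCommGroup F] [NormedSpace ℝ F]
    {f : Phase d → F} (hf : IsAnglePeriodic f) : IsAnglePeriodic (fderiv ℝ f) := by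
  intro x k
  rw [← fderiv_comp_add_right]
  exact congrArg (fderiv ℝ · x) (funext fun y => hf y k)

lemma IsAnglePeriodic.comp {F G : Type*} {f : Phase d → F} (hf : IsAnglePeriodic f) (g : F → G) :
    IsAnglePeriodic fun x => g (f x) := fun x k => by simp only [hf x k]

/-- The weight `(1 + |k|)^(-N)` on the Fourier modes, with the sup norm on `ℤ^d`. -/
def weight (N : ℕ) (k : Fin d → ℤ) : ℝ≥0 := ((1 + ‖k‖₊) ^ N)⁻¹

lemma weight_add (M N : ℕ) (k : Fin d → ℤ) : weight (M + N) k = weight M k * weight N k := by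
  rw [weight, weight, weight, pow_add, mul_inv]

lemma summable_inv_one_add_abs_sq : Summable fun n : ℤ => ((1 + |(n : ℝ)|) ^ 2)⁻¹ := by
  refine Summable.of_nonneg_of_le (fun n => by positivity)
    (f := fun n : ℤ => 1 / (n : ℝ) ^ 2 + (if n = 0 then 1 else 0)) (fun n => ?_)
    ((Real.summable_one_div_int_pow.2 one_lt_two).add
      (summable_of_ne_finset_zero (s := {0}) fun n hn => by simpa using hn))
  rcases eq_or_ne n 0 with rfl | hn
  · simp
  · have : 0 < |(n : ℝ)| := by simpa using hn
    rw [if_neg hn, add_zero, one_div, ← sq_abs (n : ℝ)]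
    gcongr
    linarith

lemma weight_two_mul_le_prod (k : Fin d → ℤ) :
    (weight (2 * d) k : ℝ) ≤ ∏ i, ((1 + |(k i : ℝ)|) ^ 2)⁻¹ := by
  have hconst : ((1 + ‖k‖) ^ 2) ^ d = ∏ _i : Fin d, (1 + ‖k‖) ^ 2 := by simp
  rw [weight, Finset.prod_inv_distrib, pow_mul]
  push_cast
  refine inv_anti₀ (Finset.prod_pos fun i _ => by positivity) ?_
  rw [hconst]
  gcongr with i
  simpa [Int.norm_eq_abs] using norm_le_pi_norm k i

lemma summable_weight : Summable (weight (d := d) (2 * d)) := by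
  classical
  let g : ℤ → ℝ := fun n => ((1 + |(n : ℝ)|) ^ 2)⁻¹
  have hg : ∀ n, 0 ≤ g n := fun n => by positivity
  rw [← NNReal.summable_coe]
  refine summable_of_sum_le (c := (∑' n, g n) ^ d) (fun k => by positivity) fun s => ?_
  calc ∑ k ∈ s, (weight (2 * d) k : ℝ)
      ≤ ∑ k ∈ s, ∏ i, g (k i) := Finset.sum_le_sum fun k _ => weight_two_mul_le_prod k
    _ ≤ ∑ k ∈ Fintype.piFinset fun i => s.image fun k => k i, ∏ i, g (k i) :=
        Finset.sum_le_sum_of_subset_of_nonneg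
          (fun k hk => Fintype.mem_piFinset.2 fun i => Finset.mem_image_of_mem _ hk)
          fun k _ _ => Finset.prod_nonneg fun i _ => hg _
    _ = ∏ i : Fin d, ∑ n ∈ s.image (fun k => k i), g n := (Finset.prod_univ_sum _ _).symm
    _ ≤ ∏ _i : Fin d, ∑' n, g n :=
        Finset.prod_le_prod (fun i _ => Finset.sum_nonneg fun n _ => hg n)
          fun i _ => summable_inv_one_add_abs_sq.sum_le_tsum _ fun n _ => hg n
    _ = (∑' n, g n) ^ d := by simp

lemma one_add_norm_pow_le (N : ℕ) (k : Fin d → ℤ) :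
    (1 + ‖k‖) ^ N ≤ 2 ^ N * (1 + ∑ j, |(k j : ℝ)| ^ N) := by
  rcases isEmpty_or_nonempty (Fin d) with h | h
  · rw [Subsingleton.elim k 0, norm_zero, add_zero, one_pow]
    exact one_le_mul_of_one_le_of_one_le (one_le_pow₀ one_le_two) (by simp)
  obtain ⟨j, -, hj⟩ := Finset.exists_mem_eq_sup Finset.univ Finset.univ_nonempty fun j => ‖k j‖₊
  have hkj : ‖k‖ = |(k j : ℝ)| := by rw [Pi.norm_def, hj, coe_nnnorm, Int.norm_eq_abs]
  calc (1 + ‖k‖) ^ N ≤ 2 ^ (N - 1) * (1 ^ N + ‖k‖ ^ N) :=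
        add_pow_le zero_le_one (norm_nonneg k) N
    _ ≤ 2 ^ N * (1 + ∑ j, |(k j : ℝ)| ^ N) := by
        rw [one_pow, hkj]
        gcongr
        · exact one_le_two
        · exact N.sub_le 1
        · exact Finset.single_le_sum (f := fun j => |(k j : ℝ)| ^ N) (fun _ _ => by positivity)
            (Finset.mem_univ j)

variable {ι : Type*} {E : Type*} [NormedAddCommGroup E] [NormedSpace ℝ E] [NormedSpace ℂ E]
  [IsScalarTower ℝ ℂ E] {f : ι → Phase d → E} {η : ι → ℝ≥0}

lemma hasFDerivAt_fproj_of_smoothBigO (hf : SmoothBigO f η) (i : ι) (k : Fin d → ℤ) (x : Phase d) :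
    HasFDerivAt (fproj k (f i)) (fproj k (fderiv ℝ (f i)) x) x := by
  obtain ⟨D, hD⟩ := hf.norm_fderiv_le
  exact hasFDerivAt_fproj k ((hf.smooth i).of_le (by simp)) (hD i) x

lemma fderiv_fproj (hf : SmoothBigO f η) (i : ι) (k : Fin d → ℤ) :
    fderiv ℝ (fproj k (f i)) = fproj k (fderiv ℝ (f i)) :=
  funext fun x => (hasFDerivAt_fproj_of_smoothBigO hf i k x).fderiv

lemma fproj_fderiv_apply_of_smoothBigO (hf : SmoothBigO f η) (hp : ∀ i, IsAnglePeriodic (f i))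
    (i : ι) (k : Fin d → ℤ) (x : Phase d) (v : Vec d) :
    fproj k (fderiv ℝ (f i)) x (0, v) = (Complex.I * (dotInt k v : ℂ)) • fproj k (f i) x := by
  obtain ⟨D, hD⟩ := hf.norm_fderiv_le
  exact fproj_fderiv_apply k (hp i) ((hf.smooth i).of_le (by simp)) (hD i) x v

lemma contDiff_fproj (hf : SmoothBigO f η) (i : ι) (k : Fin d → ℤ) :
    ContDiff ℝ ∞ (fproj k (f i)) := by
  rw [contDiff_infty]
  intro n
  induction n generalizing E with
  | zero =>
    exact contDiff_zero.2 <| continuous_iff_continuousAt.2 fun x =>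
      (hasFDerivAt_fproj_of_smoothBigO hf i k x).continuousAt
  | succ n ih =>
    rw [Nat.cast_succ, contDiff_succ_iff_fderiv, fderiv_fproj hf]
    exact ⟨fun x => (hasFDerivAt_fproj_of_smoothBigO hf i k x).differentiableAt, by simp,
      ih hf.fderiv_right⟩

variable [CompleteSpace E]

lemma pow_mul_norm_fproj_le (hf : SmoothBigO f η) (hp : ∀ i, IsAnglePeriodic (f i)) (N : ℕ)
    (j : Fin d) : ∃ C : ℝ≥0, ∀ i k x, |(k j : ℝ)| ^ N * ‖fproj k (f i) x‖ ≤ C * η i := by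
  induction N generalizing f with
  | zero =>
    obtain ⟨C, hC⟩ := hf.norm_le
    exact ⟨C, fun i k x => by simpa using norm_fproj_le k (hC i) x⟩
  | succ N ih =>
    let e : Vec d := EuclideanSpace.single j 1
    let L : (Phase d →L[ℝ] E) →L[ℝ] E := ContinuousLinearMap.apply ℝ E ((0, e) : Phase d)
    obtain ⟨C, hC⟩ := ih (hf.fderiv_right.clm L) fun i => (hp i).fderiv_right.comp L
    refine ⟨C, fun i k x => (le_of_eq ?_).trans (hC i k x)⟩
    have hderiv : L (fproj k (fderiv ℝ (f i)) x) =
        (Complex.I * (dotInt k e : ℂ)) • fproj k (f i) x :=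
      fproj_fderiv_apply_of_smoothBigO hf hp i k x e
    have hdot : dotInt k e = k j := by simp [dotInt, e]
    rw [fproj_clm L (fun c e => rfl) k (hf.fderiv_right.smooth i).continuous x, hderiv, norm_smul,
      hdot, norm_mul, Complex.norm_I, one_mul, Complex.norm_real, Real.norm_eq_abs, pow_succ,
      mul_assoc]

lemma derivBigO_zero_fproj (hf : SmoothBigO f η) (hp : ∀ i, IsAnglePeriodic (f i)) (N : ℕ) :
    DerivBigO 0 (fun p : ι × (Fin d → ℤ) => fproj p.2 (f p.1))
      (fun p => weight N p.2 * η p.1) := by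
  choose C hC using pow_mul_norm_fproj_le hf hp N
  obtain ⟨C₀, hC₀⟩ := hf.norm_le
  refine ⟨2 ^ N * (C₀ + ∑ j, C j), fun ⟨i, k⟩ x => ?_⟩
  rw [norm_iteratedFDeriv_zero]
  have hpow : (1 + ‖k‖) ^ N * ‖fproj k (f i) x‖ ≤ 2 ^ N * ((C₀ + ∑ j, (C j : ℝ)) * η i) := by
    calc (1 + ‖k‖) ^ N * ‖fproj k (f i) x‖
        ≤ 2 ^ N * (1 + ∑ j, |(k j : ℝ)| ^ N) * ‖fproj k (f i) x‖ := by
          gcongr; exact one_add_norm_pow_le N k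
      _ = 2 ^ N * (‖fproj k (f i) x‖ + ∑ j, |(k j : ℝ)| ^ N * ‖fproj k (f i) x‖) := by
          rw [mul_assoc, add_mul, one_mul, Finset.sum_mul]
      _ ≤ 2 ^ N * (C₀ * η i + ∑ j, (C j : ℝ) * η i) :=
          mul_le_mul_of_nonneg_left (add_le_add (norm_fproj_le k (hC₀ i) x)
            (Finset.sum_le_sum fun j _ => hC j i k x)) (by positivity)
      _ = 2 ^ N * ((C₀ + ∑ j, (C j : ℝ)) * η i) := by rw [add_mul, Finset.sum_mul]
  calc ‖fproj k (f i) x‖ = ((1 + ‖k‖) ^ N)⁻¹ * ((1 + ‖k‖) ^ N * ‖fproj k (f i) x‖) := by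
        field_simp
    _ ≤ ((1 + ‖k‖) ^ N)⁻¹ * (2 ^ N * ((C₀ + ∑ j, (C j : ℝ)) * η i)) := by gcongr
    _ = _ := by simp only [weight]; push_cast; ring

lemma smoothBigO_fproj (hf : SmoothBigO f η) (hp : ∀ i, IsAnglePeriodic (f i)) (N : ℕ) :
    SmoothBigO (fun p : ι × (Fin d → ℤ) => fproj p.2 (f p.1))
      (fun p => weight N p.2 * η p.1) where
  smooth p := contDiff_fproj hf p.1 p.2
  bound n := by
    induction n generalizing E with
    | zero => exact derivBigO_zero_fproj hf hp N
    | succ n ih =>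
      rw [derivBigO_succ_iff, show (fun p : ι × (Fin d → ℤ) => fderiv ℝ (fproj p.2 (f p.1))) =
        fun p => fproj p.2 (fderiv ℝ (f p.1)) from funext fun p => fderiv_fproj hf p.1 p.2]
      exact ih (f := fun i => fderiv ℝ (f i)) hf.fderiv_right fun i => (hp i).fderiv_right

lemma summable_fproj (hf : SmoothBigO f η) (hp : ∀ i, IsAnglePeriodic (f i)) (i : ι)
    (x : Phase d) : Summable fun k => fproj k (f i) x := by
  obtain ⟨C, hC⟩ := (smoothBigO_fproj hf hp (2 * d)).norm_le
  refine Summable.of_norm_bounded (g := fun k => C * (weight (2 * d) k * η i)) ?_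
    fun k => by simpa using hC (i, k) x
  exact ((NNReal.summable_coe.2 summable_weight).mul_right _).mul_left _

lemma hasSum_fproj_complex {f : ι → Phase d → ℂ} (hf : SmoothBigO f η)
    (hp : ∀ i, IsAnglePeriodic (f i)) (i : ι) (x : Phase d) :
    HasSum (fun k => fproj k (f i) x) (f i x) := by
  let F : C(UnitAddTorus (Fin d), ℂ) :=
    ⟨descend (f i) x, continuous_descend (hp i) (hf.smooth i).continuous x⟩
  have hcoeff : (fun k => fproj k (f i) x) = mFourierCoeff F :=
    funext fun k => fproj_eq_integral_descend k (hp i) x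
  have hangle : angle (0 : Fin d → ℝ) = 0 := by ext <;> simp [angle]
  have hmode : ∀ k : Fin d → ℤ, mFourier k (torusMk 0) = 1 := fun k => by
    rw [mFourier_torusMk, hangle]
    simp [dotInt]
  have hval : F (torusMk 0) = f i x :=
    (descend_torusMk (hp i) x 0).trans (by rw [hangle, add_zero])
  have hsum := hasSum_mFourier_series_apply_of_summable (hcoeff ▸ summable_fproj hf hp i x)
    (torusMk 0)
  rw [hcoeff]
  simpa only [hmode, hval, smul_eq_mul, mul_one] using hsum

lemma hasSum_fproj (hf : SmoothBigO f η) (hp : ∀ i, IsAnglePeriodic (f i)) (i : ι)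
    (x : Phase d) : HasSum (fun k => fproj k (f i) x) (f i x) := by
  have hsum := (summable_fproj hf hp i x).hasSum
  suffices ∑' k, fproj k (f i) x = f i x by rwa [this] at hsum
  rw [← sub_eq_zero]
  refine SeparatingDual.eq_zero_of_forall_dual_eq_zero (R := ℂ) fun φ => ?_
  let L : E →L[ℝ] ℂ := φ.restrictScalars ℝ
  have hcomplex := hasSum_fproj_complex (hf.clm L) (fun i => (hp i).comp L) i x
  simp only [fproj_clm L φ.map_smul _ (hf.smooth i).continuous] at hcomplex
  rw [map_sub, sub_eq_zero]
  exact (hsum.mapL L).unique hcomplex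

end FourierDecay

section Multipliers

lemma SmoothBigO.sum {ι κ X F : Type*} [NormedAddCommGroup X] [NormedSpace ℝ X]
    [NormedAddCommGroup F] [NormedSpace ℝ F] {g : ι × κ → X → F} {η : ι → ℝ≥0} {w : κ → ℝ≥0}
    (hg : SmoothBigO g fun p => w p.2 * η p.1) (hw : Summable w) (s : ι → Finset κ) :
    SmoothBigO (fun i x => ∑ k ∈ s i, g (i, k) x) η where
  smooth i := ContDiff.sum fun k _ => hg.smooth (i, k)
  bound n := by
    obtain ⟨C, hC⟩ := hg.bound n
    refine ⟨C * ∑' k, w k, fun i x => ?_⟩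
    rw [iteratedFDeriv_fun_sum_apply fun k _ =>
      (hg.smooth (i, k)).contDiffAt.of_le (by exact_mod_cast le_top)]
    calc ‖∑ k ∈ s i, iteratedFDeriv ℝ n (g (i, k)) x‖
        ≤ ∑ k ∈ s i, (C : ℝ) * ((w k * η i : ℝ≥0) : ℝ) :=
          (norm_sum_le _ _).trans (Finset.sum_le_sum fun k _ => hC (i, k) x)
      _ = ((C * ∑ k ∈ s i, w k : ℝ≥0) : ℝ) * η i := by
          push_cast
          rw [Finset.mul_sum, Finset.sum_mul]
          exact Finset.sum_congr rfl fun k _ => by ring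
      _ ≤ ((C * ∑' k, w k : ℝ≥0) : ℝ) * η i := by
          gcongr
          exact hw.sum_le_tsum _ fun _ _ => zero_le

lemma norm_sub_sum_le_of_hasSum {κ E : Type*} [NormedAddCommGroup E] {u : κ → E} {e : E}
    (hu : HasSum u e) (s : Finset κ) {w : κ → ℝ≥0} (hw : Summable w) {A : ℝ≥0}
    (h : ∀ k, k ∉ s → ‖u k‖ ≤ A * w k) : ‖e - ∑ k ∈ s, u k‖ ≤ A * (∑' k, w k : ℝ≥0) := by
  have hAw : Summable fun k => (A : ℝ) * (w k : ℝ) := (NNReal.summable_coe.2 hw).mul_left _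
  have hcompl : Summable fun k : {k // k ∉ s} => (A : ℝ) * (w k.1 : ℝ) :=
    hAw.comp_injective Subtype.val_injective
  rw [← ((s.hasSum_iff_compl).1 hu).tsum_eq, NNReal.coe_tsum, ← tsum_mul_left]
  exact (tsum_of_norm_bounded hcompl.hasSum fun k => h k.1 k.2).trans
    (hcompl.tsum_le_tsum_of_inj Subtype.val Subtype.val_injective (fun _ _ => by positivity)
      (fun _ => le_rfl) hAw)

variable {d : ℕ} {ι : Type*} {η : ι → ℝ≥0}

lemma norm_intVec_le_mul (k : Fin d → ℤ) : ‖intVec k‖ ≤ d * ‖k‖ := by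
  rw [EuclideanSpace.norm_eq]
  refine Real.sqrt_le_iff.2 ⟨by positivity, ?_⟩
  calc ∑ i, ‖intVec k i‖ ^ 2 ≤ ∑ _i : Fin d, ‖k‖ ^ 2 := by
        gcongr with i
        simpa [intVec, Int.norm_eq_abs] using norm_le_pi_norm k i
    _ = d * ‖k‖ ^ 2 := by simp
    _ ≤ d ^ 2 * ‖k‖ ^ 2 := by
        gcongr
        exact_mod_cast Nat.le_self_pow two_ne_zero d
    _ = (d * ‖k‖) ^ 2 := by ring

lemma weight_le_of_notMem_modes (N : ℕ) {K : ℕ} {k : Fin d → ℤ} (hk : k ∉ modes d K) :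
    weight N k ≤ (d + 1) ^ N * ((1 + (K : ℝ≥0)) ^ N)⁻¹ := by
  rw [weight, ← div_eq_mul_inv, le_div_iff₀ (by positivity), ← div_eq_inv_mul,
    div_le_iff₀ (by positivity), ← mul_pow]
  gcongr
  rw [mem_modes_iff, not_le] at hk
  have hle := norm_intVec_le_mul k
  rw [← NNReal.coe_le_coe]
  push_cast
  nlinarith [norm_nonneg k]

section Tail

variable {E : Type*} [NormedAddCommGroup E] [NormedSpace ℝ E] [NormedSpace ℂ E]

/-- The part of `f` made of the Fourier modes outside `s`. -/
def fourierTail (s : Finset (Fin d → ℤ)) (f : Phase d → E) (x : Phase d) : E :=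
  f x - ∑ k ∈ s, fproj k f x

variable [IsScalarTower ℝ ℂ E] {f : ι → Phase d → E}

lemma fderiv_fourierTail (hf : SmoothBigO f η) (i : ι) (s : Finset (Fin d → ℤ)) :
    fderiv ℝ (fourierTail s (f i)) = fourierTail s (fderiv ℝ (f i)) :=
  funext fun x => ((hf.differentiable i x).hasFDerivAt.fun_sub <|
    HasFDerivAt.fun_sum fun k _ => hasFDerivAt_fproj_of_smoothBigO hf i k x).fderiv

variable [CompleteSpace E]

lemma derivBigO_zero_fourierTail (hf : SmoothBigO f η) (hp : ∀ i, IsAnglePeriodic (f i))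
    (K : ι → ℕ) (N : ℕ) :
    DerivBigO 0 (fun i => fourierTail (modes d (K i)) (f i))
      (fun i => ((1 + (K i : ℝ≥0)) ^ N)⁻¹ * η i) := by
  obtain ⟨C, hC⟩ := (smoothBigO_fproj hf hp (N + 2 * d)).norm_le
  refine ⟨(d + 1) ^ N * C * ∑' k : Fin d → ℤ, weight (2 * d) k, fun i x => ?_⟩
  have hterm : ∀ k, k ∉ modes d (K i) → ‖fproj k (f i) x‖ ≤
      ((d + 1) ^ N * C * (((1 + (K i : ℝ≥0)) ^ N)⁻¹ * η i) : ℝ≥0) * weight (2 * d) k := by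
    intro k hk
    refine (hC (i, k) x).trans ?_
    rw [← NNReal.coe_mul, ← NNReal.coe_mul, NNReal.coe_le_coe]
    calc C * (weight (N + 2 * d) k * η i)
        = C * (weight N k * weight (2 * d) k * η i) := by rw [weight_add]
      _ ≤ C * ((d + 1) ^ N * ((1 + (K i : ℝ≥0)) ^ N)⁻¹ * weight (2 * d) k * η i) := by
          gcongr; exact weight_le_of_notMem_modes N hk
      _ = _ := by ring
  rw [norm_iteratedFDeriv_zero]
  refine (norm_sub_sum_le_of_hasSum (hasSum_fproj hf hp i x) _ summable_weight hterm).trans_eq ?_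
  push_cast
  ring

lemma smoothBigO_fourierTail (hf : SmoothBigO f η) (hp : ∀ i, IsAnglePeriodic (f i)) (K : ι → ℕ)
    (N : ℕ) :
    SmoothBigO (fun i => fourierTail (modes d (K i)) (f i))
      (fun i => ((1 + (K i : ℝ≥0)) ^ N)⁻¹ * η i) where
  smooth i := (hf.smooth i).sub (ContDiff.sum fun k _ => contDiff_fproj hf i k)
  bound n := by
    induction n generalizing E with
    | zero => exact derivBigO_zero_fourierTail hf hp K N
    | succ n ih =>
      simp only [derivBigO_succ_iff, fderiv_fourierTail hf]
      exact ih (f := fun i => fderiv ℝ (f i)) hf.fderiv_right fun i => (hp i).fderiv_right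

end Tail

/-- The linear form `(p, q) ↦ k · p`. -/
def dotL (k : Fin d → ℤ) : Phase d →L[ℝ] ℝ :=
  (innerSL ℝ (intVec k)).comp (ContinuousLinearMap.fst ℝ (Vec d) (Vec d))

lemma dotL_apply (k : Fin d → ℤ) (x : Phase d) : dotL k x = dotInt k x.1 := by
  simp [dotL, inner_intVec]

lemma norm_dotL_le (k : Fin d → ℤ) : ‖dotL k‖ ≤ d * ‖k‖ := by
  calc ‖dotL k‖ ≤ ‖innerSL ℝ (intVec k)‖ * ‖ContinuousLinearMap.fst ℝ (Vec d) (Vec d)‖ :=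
        ContinuousLinearMap.opNorm_comp_le _ _
    _ ≤ ‖intVec k‖ * 1 := by
        rw [innerSL_apply_norm]
        gcongr
        exact ContinuousLinearMap.norm_fst_le _ _ _
    _ ≤ d * ‖k‖ := by rw [mul_one]; exact norm_intVec_le_mul k

/-- The Fourier multiplier with symbol `a (k · p)`, restricted to the modes in `s`. -/
def multiplier (a : ℝ → ℂ) (s : Finset (Fin d → ℤ)) (f : Phase d → ℂ) (x : Phase d) : ℂ :=
  ∑ k ∈ s, a (dotL k x) * fproj k f x

variable {a : ℝ → ℂ} {f : ι → Phase d → ℂ}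

lemma derivBigO_comp_dotL (ha : SmoothBigO (fun _ : Unit => a) 1) (m : ℕ) :
    DerivBigO m (fun (k : Fin d → ℤ) x => a (dotL k x)) fun k => (1 + ‖k‖₊) ^ m := by
  obtain ⟨C, hC⟩ := ha.bound m
  refine ⟨C * d ^ m, fun k x => ?_⟩
  have hcomp : iteratedFDeriv ℝ m (fun x => a (dotL k x)) x = _ :=
    (dotL k).iteratedFDeriv_comp_right (ha.smooth ()) x (i := m) (by exact_mod_cast le_top)
  have ha_le : ‖iteratedFDeriv ℝ m a (dotL k x)‖ ≤ C := by simpa using hC () (dotL k x)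
  have hk : ‖dotL k‖ ≤ d * (1 + ‖k‖) := (norm_dotL_le k).trans (by gcongr; linarith)
  rw [hcomp]
  calc _ ≤ ‖iteratedFDeriv ℝ m a (dotL k x)‖ * ∏ _i : Fin m, ‖dotL k‖ :=
        ContinuousMultilinearMap.norm_compContinuousLinearMap_le _ _
    _ ≤ C * (d * (1 + ‖k‖)) ^ m := by
        rw [Finset.prod_const, Finset.card_univ, Fintype.card_fin]
        gcongr
    _ = _ := by push_cast; rw [mul_pow]; ring

/-- The growth of the derivatives of the symbol in `k` is absorbed by the decay of `fproj k`. -/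
lemma smoothBigO_symbol_mul_fproj (ha : SmoothBigO (fun _ : Unit => a) 1) (hf : SmoothBigO f η)
    (hp : ∀ i, IsAnglePeriodic (f i)) :
    SmoothBigO (fun (p : ι × (Fin d → ℤ)) x => a (dotL p.2 x) * fproj p.2 (f p.1) x)
      (fun p => weight (2 * d) p.2 * η p.1) := by
  have hsymbol : ∀ p : ι × (Fin d → ℤ), ContDiff ℝ ∞ fun x => a (dotL p.2 x) := fun p =>
    (ha.smooth ()).comp (dotL p.2).contDiff
  refine ⟨fun p => (hsymbol p).mul (contDiff_fproj hf p.1 p.2), fun n => ?_⟩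
  have hsymbol_le : ∀ m ≤ n, DerivBigO m (fun (p : ι × (Fin d → ℤ)) x => a (dotL p.2 x))
      (fun p => (1 + ‖p.2‖₊) ^ n) := by
    intro m hm
    obtain ⟨C, hC⟩ := derivBigO_comp_dotL (d := d) ha m
    refine ⟨C, fun p x => (hC p.2 x).trans ?_⟩
    have hpow : (1 + ‖p.2‖₊) ^ m ≤ (1 + ‖p.2‖₊) ^ n := pow_le_pow_right₀ (by simp) hm
    gcongr
  have hweight : (fun p : ι × (Fin d → ℤ) => weight (2 * d) p.2 * η p.1) =
      (fun p => (1 + ‖p.2‖₊) ^ n) * fun p => weight (n + 2 * d) p.2 * η p.1 := by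
    funext p
    rw [Pi.mul_apply, weight_add, weight, weight]
    field_simp
  rw [hweight]
  exact DerivBigO.bilin (ContinuousLinearMap.mul ℝ ℂ) hsymbol
    (fun p => contDiff_fproj hf p.1 p.2) hsymbol_le
    fun m _ => (smoothBigO_fproj hf hp (n + 2 * d)).bound m

lemma smoothBigO_multiplier (ha : SmoothBigO (fun _ : Unit => a) 1) (hf : SmoothBigO f η)
    (hp : ∀ i, IsAnglePeriodic (f i)) (s : ι → Finset (Fin d → ℤ)) :
    SmoothBigO (fun i => multiplier a (s i) (f i)) η :=
  (smoothBigO_symbol_mul_fproj ha hf hp).sum summable_weight s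

lemma fderiv_multiplier_apply (ha : Differentiable ℝ a) (hf : SmoothBigO f η)
    (hp : ∀ i, IsAnglePeriodic (f i)) (i : ι) (s : Finset (Fin d → ℤ)) (x : Phase d) (v : Vec d) :
    fderiv ℝ (multiplier a s (f i)) x (0, v) =
      ∑ k ∈ s, a (dotL k x) * ((Complex.I * (dotInt k v : ℂ)) * fproj k (f i) x) := by
  have hsymbol : ∀ k, HasFDerivAt (fun x => a (dotL k x))
      ((fderiv ℝ a (dotL k x)).comp (dotL k)) x := fun k =>
    (ha _).hasFDerivAt.comp x (dotL k).hasFDerivAt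
  have hderiv : HasFDerivAt (multiplier a s (f i)) _ x :=
    HasFDerivAt.fun_sum fun k _ => (hsymbol k).mul (hasFDerivAt_fproj_of_smoothBigO hf i k x)
  have hdotL : ∀ k, dotL k ((0 : Vec d), v) = 0 := fun k => by simp [dotL_apply, dotInt]
  rw [hderiv.fderiv, _root_.sum_apply]
  refine Finset.sum_congr rfl fun k _ => ?_
  simp [fproj_fderiv_apply_of_smoothBigO hf hp, hdotL]

end Multipliers

/-! ### The homological equation -/

section Symbols

/-- A smooth cutoff, equal to `1` near `0` and supported in `[-1, 1]`. -/
def bump : ContDiffBump (0 : ℝ) := ⟨1 / 2, 1, by norm_num, by norm_num⟩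

lemma bump_eq_zero {x : ℝ} (hx : 1 ≤ |x|) : bump x = 0 :=
  bump.zero_of_le_dist (by simpa [bump] using hx)

lemma bump_zero : bump 0 = 1 := bump.one_of_mem_closedBall (by simp [bump])

/-- The smooth regularization `(1 - bump x) / x` of `1 / x`, which vanishes near `0`. -/
def regInv (x : ℝ) : ℝ := (1 - bump x) * x⁻¹

lemma regInv_mul_self (x : ℝ) : regInv x * x = 1 - bump x := by
  rcases eq_or_ne x 0 with rfl | hx
  · simp [bump_zero]
  · rw [regInv, mul_assoc, inv_mul_cancel₀ hx, mul_one]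

lemma contDiff_regInv : ContDiff ℝ ∞ regInv := by
  refine contDiff_iff_contDiffAt.2 fun x => ?_
  rcases eq_or_ne x 0 with rfl | hx
  · have hzero : regInv =ᶠ[nhds 0] fun _ => 0 := by
      filter_upwards [bump.eventuallyEq_one] with y hy
      simp [regInv, hy]
    exact contDiffAt_const.congr_of_eventuallyEq hzero
  · exact (contDiffAt_const.sub bump.contDiffAt).mul (contDiffAt_inv ℝ hx)

lemma smoothBigO_one_of_real {F : Type*} [NormedAddCommGroup F] [NormedSpace ℝ F] {f : ℝ → F}
    (hf : ContDiff ℝ ∞ f) (h : ∀ n, ∃ C : ℝ, ∀ x, 1 < |x| → ‖iteratedFDeriv ℝ n f x‖ ≤ C) :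
    SmoothBigO (fun _ : Unit => f) 1 where
  smooth _ := hf
  bound n := by
    obtain ⟨C, hC⟩ := h n
    obtain ⟨D, hD⟩ := (isCompact_Icc (a := (-1 : ℝ)) (b := 1)).exists_bound_of_continuousOn
      (hf.continuous_iteratedFDeriv (m := n) (by exact_mod_cast le_top)).continuousOn
    refine ⟨Real.toNNReal (max C D), fun _ x => ?_⟩
    simp only [Pi.one_apply, NNReal.coe_one, mul_one, Real.coe_toNNReal']
    refine le_trans ?_ (le_max_left _ _)
    rcases le_or_gt |x| 1 with hx | hx
    · exact (hD x (abs_le.1 hx)).trans (le_max_right _ _)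
    · exact (hC x hx).trans (le_max_left _ _)

lemma eventually_one_lt_abs {x : ℝ} (hx : 1 < |x|) : ∀ᶠ y in nhds x, 1 < |y| :=
  continuous_abs.continuousAt.eventually (lt_mem_nhds hx)

lemma smoothBigO_bump : SmoothBigO (fun (_ : Unit) (x : ℝ) => bump x) 1 := by
  refine smoothBigO_one_of_real bump.contDiff fun n => ⟨0, fun x hx => ?_⟩
  have hzero : (fun x => bump x) =ᶠ[nhds x] fun _ => (0 : ℝ) :=
    (eventually_one_lt_abs hx).mono fun y hy => bump_eq_zero hy.le
  rw [(hzero.iteratedFDeriv ℝ n).eq_of_nhds]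
  simp

lemma smoothBigO_regInv : SmoothBigO (fun _ : Unit => regInv) 1 := by
  refine smoothBigO_one_of_real contDiff_regInv fun n => ⟨n.factorial, fun x hx => ?_⟩
  have hinv : regInv =ᶠ[nhds x] fun y => y⁻¹ :=
    (eventually_one_lt_abs hx).mono fun y hy => by simp [regInv, bump_eq_zero hy.le]
  rw [(hinv.iteratedFDeriv ℝ n).eq_of_nhds, norm_iteratedFDeriv_eq_norm_iteratedDeriv,
    iteratedDeriv_eq_iterate, iter_deriv_inv]
  simp only [norm_mul, norm_pow, norm_neg, norm_one, one_pow, one_mul, norm_zpow,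
    Real.norm_eq_abs, Nat.abs_cast]
  exact mul_le_of_le_one_right (by positivity) (zpow_le_one_of_nonpos₀ hx.le (by omega))

/-- The symbol of the solution operator of the homological equation. -/
def solSymbol (x : ℝ) : ℂ := Complex.I * (regInv x : ℂ)

/-- The symbol of the projection onto the resonant modes. -/
def resSymbol (x : ℝ) : ℂ := (bump x : ℂ)

lemma smoothBigO_resSymbol : SmoothBigO (fun _ : Unit => resSymbol) 1 :=
  smoothBigO_bump.clm Complex.ofRealCLM

lemma smoothBigO_solSymbol : SmoothBigO (fun _ : Unit => solSymbol) 1 :=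
  smoothBigO_regInv.clm (Complex.I • Complex.ofRealCLM)

end Symbols

section Homological

variable {d : ℕ}

lemma fproj_sub (k : Fin d → ℤ) {f g : Phase d → ℂ} (hf : Continuous f) (hg : Continuous g)
    (x : Phase d) : fproj k (fun x => f x - g x) x = fproj k f x - fproj k g x := by
  simp only [fproj, smul_sub]
  exact MeasureTheory.integral_sub (integrableOn_fproj_integrand k hf x)
    (integrableOn_fproj_integrand k hg x)

lemma multiplier_sub (a : ℝ → ℂ) (s : Finset (Fin d → ℤ)) {f g : Phase d → ℂ} (hf : Continuous f)
    (hg : Continuous g) (x : Phase d) :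
    multiplier a s (fun x => f x - g x) x = multiplier a s f x - multiplier a s g x := by
  simp only [multiplier, fproj_sub _ hf hg, mul_sub, Finset.sum_sub_distrib]

lemma isAnglePeriodic_multiplier {f : Phase d → ℂ} (hf : IsAnglePeriodic f) (a : ℝ → ℂ)
    (s : Finset (Fin d → ℤ)) : IsAnglePeriodic (multiplier a s f) := by
  intro x k
  refine Finset.sum_congr rfl fun l _ => ?_
  congr 1
  · simp only [dotL_apply, Prod.fst_add, add_zero]
  · simp only [fproj, add_right_comm x, hf _ k]

/-- Complexification of a real function. -/
def cplx (f : Phase d → ℝ) (x : Phase d) : ℂ := (f x : ℂ)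

/-- The resonant part of `f`: the Fourier modes in `modes d K`, each cut off smoothly to the zone
`|k · p| ≤ 1`. -/
def resPart (K : ℕ) (f : Phase d → ℝ) (x : Phase d) : ℝ :=
  (multiplier resSymbol (modes d K) (cplx f) x).re

/-- The solution `S` of the homological equation `p · ∂_q S + f = resPart f`, up to the Fourier
tail of `f`. -/
def homSol (K : ℕ) (f : Phase d → ℝ) (x : Phase d) : ℝ :=
  (multiplier solSymbol (modes d K) (cplx f) x).re

section Single

variable {f g : Phase d → ℝ}

lemma isAnglePeriodic_cplx (hf : IsAnglePeriodic f) : IsAnglePeriodic (cplx f) := hf.comp _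

lemma isAnglePeriodic_resPart (hf : IsAnglePeriodic f) (K : ℕ) : IsAnglePeriodic (resPart K f) :=
  (isAnglePeriodic_multiplier (isAnglePeriodic_cplx hf) _ _).comp _

lemma isAnglePeriodic_homSol (hf : IsAnglePeriodic f) (K : ℕ) : IsAnglePeriodic (homSol K f) :=
  (isAnglePeriodic_multiplier (isAnglePeriodic_cplx hf) _ _).comp _

lemma re_multiplier_cplx_sub (a : ℝ → ℂ) (s : Finset (Fin d → ℤ)) (hf : Continuous f)
    (hg : Continuous g) (x : Phase d) :
    (multiplier a s (cplx fun x => f x - g x) x).re =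
      (multiplier a s (cplx f) x).re - (multiplier a s (cplx g) x).re := by
  have hcplx : cplx (fun x => f x - g x) = fun x => cplx f x - cplx g x :=
    funext fun x => Complex.ofReal_sub _ _
  rw [hcplx, multiplier_sub a s (f := cplx f) (g := cplx g) (Complex.continuous_ofReal.comp hf)
    (Complex.continuous_ofReal.comp hg), Complex.sub_re]

lemma resPart_sub (K : ℕ) (hf : Continuous f) (hg : Continuous g) (x : Phase d) :
    resPart K (fun x => f x - g x) x = resPart K f x - resPart K g x :=
  re_multiplier_cplx_sub _ _ hf hg x

lemma homSol_sub (K : ℕ) (hf : Continuous f) (hg : Continuous g) (x : Phase d) :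
    homSol K (fun x => f x - g x) x = homSol K f x - homSol K g x :=
  re_multiplier_cplx_sub _ _ hf hg x

end Single

section Family

variable {ι : Type*} {f : ι → Phase d → ℝ} {η : ι → ℝ≥0}

lemma smoothBigO_cplx (hf : SmoothBigO f η) : SmoothBigO (fun i => cplx (f i)) η :=
  hf.clm Complex.ofRealCLM

lemma smoothBigO_resPart (hf : SmoothBigO f η) (hp : ∀ i, IsAnglePeriodic (f i)) (K : ι → ℕ) :
    SmoothBigO (fun i => resPart (K i) (f i)) η :=
  (smoothBigO_multiplier smoothBigO_resSymbol (smoothBigO_cplx hf)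
    (fun i => isAnglePeriodic_cplx (hp i)) fun i => modes d (K i)).clm Complex.reCLM

lemma smoothBigO_homSol (hf : SmoothBigO f η) (hp : ∀ i, IsAnglePeriodic (f i)) (K : ι → ℕ) :
    SmoothBigO (fun i => homSol (K i) (f i)) η :=
  (smoothBigO_multiplier smoothBigO_solSymbol (smoothBigO_cplx hf)
    (fun i => isAnglePeriodic_cplx (hp i)) fun i => modes d (K i)).clm Complex.reCLM

lemma fderiv_homSol_apply (hf : SmoothBigO f η) (hp : ∀ i, IsAnglePeriodic (f i)) (i : ι) (K : ℕ)
    (x : Phase d) (v : Vec d) :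
    fderiv ℝ (homSol K (f i)) x (0, v) =
      (∑ k ∈ modes d K, solSymbol (dotL k x) *
        ((Complex.I * (dotInt k v : ℂ)) * fproj k (cplx (f i)) x)).re := by
  have hf' := smoothBigO_cplx hf
  have hp' : ∀ i, IsAnglePeriodic (cplx (f i)) := fun i => isAnglePeriodic_cplx (hp i)
  have hdiff : DifferentiableAt ℝ (multiplier solSymbol (modes d K) (cplx (f i))) x :=
    (smoothBigO_multiplier smoothBigO_solSymbol hf' hp' fun _ => modes d K).differentiable i x
  have hderiv : HasFDerivAt (homSol K (f i)) _ x :=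
    Complex.reCLM.hasFDerivAt.comp x hdiff.hasFDerivAt
  rw [hderiv.fderiv, ← fderiv_multiplier_apply (smoothBigO_solSymbol.differentiable ()) hf' hp']
  rfl

lemma fderiv_homSol_add_sub_resPart (hf : SmoothBigO f η) (hp : ∀ i, IsAnglePeriodic (f i)) (i : ι)
    (K : ℕ) (x : Phase d) :
    fderiv ℝ (homSol K (f i)) x (0, x.1) + f i x - resPart K (f i) x =
      (fourierTail (modes d K) (cplx (f i)) x).re := by
  have hmode : ∀ k : Fin d → ℤ,
      solSymbol (dotL k x) * ((Complex.I * (dotInt k x.1 : ℂ)) * fproj k (cplx (f i)) x) -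
        resSymbol (dotL k x) * fproj k (cplx (f i)) x = -fproj k (cplx (f i)) x := by
    intro k
    have hinv : (regInv (dotL k x) : ℂ) * (dotInt k x.1 : ℂ) = 1 - bump (dotL k x) := by
      rw [← dotL_apply]
      exact_mod_cast regInv_mul_self (dotL k x)
    rw [solSymbol, resSymbol]
    linear_combination (Complex.I * Complex.I * fproj k (cplx (f i)) x) * hinv +
      (1 - (bump (dotL k x) : ℂ)) * fproj k (cplx (f i)) x * Complex.I_mul_I
  rw [fderiv_homSol_apply hf hp, show f i x = (cplx (f i) x).re from rfl, resPart,
    ← Complex.add_re, ← Complex.sub_re, fourierTail, multiplier, add_comm, add_sub_assoc,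
    ← Finset.sum_sub_distrib, Finset.sum_congr rfl fun k _ => hmode k, Finset.sum_neg_distrib,
    sub_eq_add_neg]

end Family

lemma neg_mem_modes {K : ℕ} {k : Fin d → ℤ} (hk : k ∈ modes d K) : -k ∈ modes d K := by
  rw [mem_modes_iff] at hk ⊢
  have hneg : intVec (-k) = -intVec k := by ext i; simp [intVec]
  rwa [hneg, norm_neg]

lemma dotInt_neg (k : Fin d → ℤ) (v : Vec d) : dotInt (-k) v = -dotInt k v := by simp [dotInt]

lemma re_sum_mul_exp (K : ℕ) (a : (Fin d → ℤ) → ℂ) (q : Vec d) :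
    ((∑ k ∈ modes d K, a k * Complex.exp (Complex.I * (dotInt k q : ℂ))).re : ℂ) =
      ∑ k ∈ modes d K, (a k + (starRingEnd ℂ) (a (-k))) / 2 *
        Complex.exp (Complex.I * (dotInt k q : ℂ)) := by
  have hconj : (starRingEnd ℂ) (∑ k ∈ modes d K, a k * Complex.exp (Complex.I * (dotInt k q : ℂ))) =
      ∑ k ∈ modes d K, (starRingEnd ℂ) (a (-k)) * Complex.exp (Complex.I * (dotInt k q : ℂ)) := by
    rw [map_sum]
    refine Finset.sum_nbij' (fun k => -k) (fun k => -k) (fun k hk => neg_mem_modes hk)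
      (fun k hk => neg_mem_modes hk) (fun k _ => neg_neg k) (fun k _ => neg_neg k) fun k _ => ?_
    rw [map_mul, neg_neg, ← Complex.exp_conj, dotInt_neg]
    simp
  rw [Complex.re_eq_add_conj, hconj, ← Finset.sum_add_distrib, Finset.sum_div]
  exact Finset.sum_congr rfl fun k _ => by ring

/-- `Z` is a trigonometric polynomial in the angles with frequencies `|k| ≤ K`, each of whose
coefficients is supported in the resonant region `|p · k| ≤ r`. This is `IsNormalForm` with the
cutoff and the resonance width as free parameters. -/
def IsResonantTrigPoly (K : ℕ) (r : ℝ) (Z : Phase d → ℝ) : Prop :=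
  ∃ c : (Fin d → ℤ) → Vec d → ℂ,
    (∀ p q : Vec d, (Z (p, q) : ℂ) =
      ∑ k ∈ modes d K, c k p * Complex.exp (Complex.I * (dotInt k q : ℂ))) ∧
    ∀ k p, c k p ≠ 0 → |dotInt k p| ≤ r

lemma isResonantTrigPoly_resPart {f : Phase d → ℝ} (hp : IsAnglePeriodic f) (K : ℕ) :
    IsResonantTrigPoly K 1 (resPart K f) := by
  let a : (Fin d → ℤ) → Vec d → ℂ := fun k p => resSymbol (dotInt k p) * fproj k (cplx f) (p, 0)
  have ha : ∀ k p, 1 < |dotInt k p| → a k p = 0 := fun k p h => by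
    simp [a, resSymbol, bump_eq_zero h.le]
  have hexpand : ∀ p q : Vec d, multiplier resSymbol (modes d K) (cplx f) (p, q) =
      ∑ k ∈ modes d K, a k p * Complex.exp (Complex.I * (dotInt k q : ℂ)) := by
    refine fun p q => Finset.sum_congr rfl fun k _ => ?_
    rw [show ((p, q) : Phase d) = (p, 0) + (0, q) by simp, fproj_add k (isAnglePeriodic_cplx hp),
      dotL_apply]
    simp only [Prod.mk_add_mk, add_zero, zero_add, smul_eq_mul, a]
    ring
  refine ⟨fun k p => (a k p + (starRingEnd ℂ) (a (-k) p)) / 2, fun p q => ?_, fun k p hc => ?_⟩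
  · rw [resPart, hexpand]
    exact re_sum_mul_exp K (a · p) q
  · contrapose! hc
    have hc' : 1 < |dotInt (-k) p| := by rwa [dotInt_neg, abs_neg]
    simp [ha k p hc, ha (-k) p hc']

end Homological

/-! ### The Hamilton–Jacobi iteration -/

section HamiltonJacobi

variable {d : ℕ}

/-- The gradient `∂_q` attached to a differential: the vector representing its restriction to the
angles. -/
def gradQ : (Phase d →L[ℝ] ℝ) →L[ℝ] Vec d :=
  LinearMap.toContinuousLinearMap
    { toFun := fun l => (InnerProductSpace.toDual ℝ (Vec d)).symm
        (l.comp (ContinuousLinearMap.inr ℝ (Vec d) (Vec d)))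
      map_add' := fun l m => by simp
      map_smul' := fun c l => by simp }

/-- The gradient `∂_p` attached to a differential: the vector representing its restriction to the
actions. -/
def gradP : (Phase d →L[ℝ] ℝ) →L[ℝ] Vec d :=
  LinearMap.toContinuousLinearMap
    { toFun := fun l => (InnerProductSpace.toDual ℝ (Vec d)).symm
        (l.comp (ContinuousLinearMap.inl ℝ (Vec d) (Vec d)))
      map_add' := fun l m => by simp
      map_smul' := fun c l => by simp }

lemma inner_gradQ (l : Phase d →L[ℝ] ℝ) (v : Vec d) : inner ℝ (gradQ l) v = l (0, v) :=
  InnerProductSpace.toDual_symm_apply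

lemma inner_gradP (l : Phase d →L[ℝ] ℝ) (v : Vec d) : inner ℝ (gradP l) v = l (v, 0) :=
  InnerProductSpace.toDual_symm_apply

/-- The displacement `(∂_q S, 0)`. -/
def shiftP (S : Phase d → ℝ) (x : Phase d) : Phase d := (gradQ (fderiv ℝ S x), 0)

/-- The displacement `(0, ∂_p S)`. -/
def shiftQ (S : Phase d → ℝ) (x : Phase d) : Phase d := (0, gradP (fderiv ℝ S x))

/-- The right-hand side of the Hamilton–Jacobi equation `p · ∂_q S + hjRHS μ W S Z = Z`, which says
that `|p|² / 2 + μ W` at `(p + ∂_q S, q)` equals `|p|² / 2 + Z` at `(p, q + ∂_p S)`. -/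
def hjRHS (μ : ℝ≥0) (W S Z : Phase d → ℝ) (x : Phase d) : ℝ :=
  μ * W (x + shiftP S x) + 1 / 2 * inner ℝ (gradQ (fderiv ℝ S x)) (gradQ (fderiv ℝ S x)) -
    (Z (x + shiftQ S x) - Z x)

/-- The iterates of the Hamilton–Jacobi equation. -/
def hjIter (μ : ℝ≥0) (K : ℕ) (W : Phase d → ℝ) : ℕ → Phase d → ℝ
  | 0 => hjRHS μ W (fun _ => 0) (fun _ => 0)
  | n + 1 => hjRHS μ W (homSol K (hjIter μ K W n)) (resPart K (hjIter μ K W n))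

/-- The defect in the Hamilton–Jacobi equation. -/
def hjDefect (μ : ℝ≥0) (W S Z : Phase d → ℝ) (x : Phase d) : ℝ :=
  freeH (x + shiftP S x) + μ * W (x + shiftP S x) -
    (freeH (x + shiftQ S x) + Z (x + shiftQ S x))

lemma freeH_eq (x : Phase d) : freeH x = inner ℝ x.1 x.1 / 2 := by
  rw [PiLp.inner_apply, Finset.sum_div]
  simp [freeH, sq]

lemma hjDefect_eq (μ : ℝ≥0) (W S Z : Phase d → ℝ) (x : Phase d) :
    hjDefect μ W S Z x = fderiv ℝ S x (0, x.1) + hjRHS μ W S Z x - Z x := by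
  simp only [hjDefect, hjRHS, freeH_eq, shiftP, shiftQ, Prod.fst_add, add_zero,
    inner_add_left, inner_add_right]
  rw [real_inner_comm (gradQ (fderiv ℝ S x)) x.1, inner_gradQ]
  ring

section Periodicity

variable {W S Z : Phase d → ℝ}

lemma isAnglePeriodic_hjRHS (hW : IsAnglePeriodic W) (hS : IsAnglePeriodic S)
    (hZ : IsAnglePeriodic Z) (μ : ℝ≥0) : IsAnglePeriodic (hjRHS μ W S Z) := by
  intro x k
  simp only [hjRHS, shiftP, shiftQ, hS.fderiv_right x k, hZ x k]
  rw [add_right_comm x, hW, add_right_comm x, hZ]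

lemma isAnglePeriodic_hjIter (hW : IsAnglePeriodic W) (μ : ℝ≥0) (K n : ℕ) :
    IsAnglePeriodic (hjIter μ K W n) := by
  induction n with
  | zero => exact isAnglePeriodic_hjRHS hW (fun _ _ => rfl) (fun _ _ => rfl) μ
  | succ n ih =>
    exact isAnglePeriodic_hjRHS hW (isAnglePeriodic_homSol ih K) (isAnglePeriodic_resPart ih K) μ

end Periodicity

section Estimates

variable {ι : Type*} {W S S' Z Z' : ι → Phase d → ℝ} {μ η θ : ι → ℝ≥0}

lemma smoothBigO_shiftP (hS : SmoothBigO S η) : SmoothBigO (fun i => shiftP (S i)) η :=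
  hS.fderiv_right.clm ((ContinuousLinearMap.inl ℝ (Vec d) (Vec d)).comp gradQ)

lemma smoothBigO_shiftQ (hS : SmoothBigO S η) : SmoothBigO (fun i => shiftQ (S i)) η :=
  hS.fderiv_right.clm ((ContinuousLinearMap.inr ℝ (Vec d) (Vec d)).comp gradP)

lemma smoothBigO_gradQ (hS : SmoothBigO S η) :
    SmoothBigO (fun i x => gradQ (fderiv ℝ (S i) x)) η := hS.fderiv_right.clm gradQ

lemma smoothBigO_hjRHS (hμ : μ ≤ 1) (hW : SmoothBigO W 1) (hS : SmoothBigO S μ)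
    (hZ : SmoothBigO Z μ) : SmoothBigO (fun i => hjRHS (μ i) (W i) (S i) (Z i)) μ := by
  have hpot : SmoothBigO (fun i x => μ i * W i (x + shiftP (S i) x)) μ := by
    simpa only [mul_one, smul_eq_mul] using
      (hW.comp_id_add ((smoothBigO_shiftP hS).mono_le hμ)).index_smul μ
  have hkin := (((smoothBigO_gradQ hS).bilin (innerSL ℝ) (smoothBigO_gradQ hS)).mono_le (θ := μ)
    fun i => mul_le_of_le_one_right zero_le (hμ i)).clm ((1 / 2 : ℝ) • ContinuousLinearMap.id ℝ ℝ)
  have hZS := hZ.comp_id_add ((smoothBigO_shiftQ hS).mono_le hμ)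
  exact (hpot.add hkin).sub (hZS.sub hZ)

section Difference

variable (hS : SmoothBigO S μ) (hS' : SmoothBigO S' μ)
  (hSS : SmoothBigO (fun i x => S i x - S' i x) θ)
include hS hS' hSS

lemma smoothBigO_fderiv_sub {F : Type*} [NormedAddCommGroup F] [NormedSpace ℝ F]
    (L : (Phase d →L[ℝ] ℝ) →L[ℝ] F) :
    SmoothBigO (fun i x => L (fderiv ℝ (S i) x) - L (fderiv ℝ (S' i) x)) θ := by
  have hsub : ∀ i x, fderiv ℝ (fun x => S i x - S' i x) x =
      fderiv ℝ (S i) x - fderiv ℝ (S' i) x := fun i x =>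
    fderiv_fun_sub (hS.differentiable i x) (hS'.differentiable i x)
  simpa only [hsub, map_sub] using hSS.fderiv_right.clm L

end Difference

lemma smoothBigO_hjRHS_sub (hμ : μ ≤ 1) (hW : SmoothBigO W 1) (hS : SmoothBigO S μ)
    (hS' : SmoothBigO S' μ) (hZ' : SmoothBigO Z' μ)
    (hSS : SmoothBigO (fun i x => S i x - S' i x) θ)
    (hZZ : SmoothBigO (fun i x => Z i x - Z' i x) θ) :
    SmoothBigO (fun i x => hjRHS (μ i) (W i) (S i) (Z i) x - hjRHS (μ i) (W i) (S' i) (Z' i) x)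
      (μ * θ) := by
  have hPd : SmoothBigO (fun i x => shiftP (S i) x - shiftP (S' i) x) θ :=
    smoothBigO_fderiv_sub hS hS' hSS ((ContinuousLinearMap.inl ℝ (Vec d) (Vec d)).comp gradQ)
  have hQd : SmoothBigO (fun i x => shiftQ (S i) x - shiftQ (S' i) x) θ :=
    smoothBigO_fderiv_sub hS hS' hSS ((ContinuousLinearMap.inr ℝ (Vec d) (Vec d)).comp gradP)
  have hpot : SmoothBigO (fun i x => (μ i : ℝ) • (W i (x + shiftP (S i) x) -
      W i (x + shiftP (S' i) x))) (μ * θ) := by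
    simpa only [one_mul] using (hW.comp_sub ((smoothBigO_shiftP hS).mono_le hμ)
      ((smoothBigO_shiftP hS').mono_le hμ) hPd).index_smul μ
  have hkin : SmoothBigO (fun i x => 1 / 2 * inner ℝ
      (gradQ (fderiv ℝ (S i) x) + gradQ (fderiv ℝ (S' i) x))
      (gradQ (fderiv ℝ (S i) x) - gradQ (fderiv ℝ (S' i) x))) (μ * θ) :=
    (((smoothBigO_gradQ hS).add (smoothBigO_gradQ hS')).bilin (innerSL ℝ)
      (smoothBigO_fderiv_sub hS hS' hSS gradQ)).clm ((1 / 2 : ℝ) • ContinuousLinearMap.id ℝ ℝ)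
  have hQS := (smoothBigO_shiftQ hS).mono_le hμ
  have hZZS : SmoothBigO (fun i x => (Z i (x + shiftQ (S i) x) - Z' i (x + shiftQ (S i) x)) -
      (Z i (x + 0) - Z' i (x + 0))) (μ * θ) := by
    rw [mul_comm]
    exact hZZ.comp_sub hQS (SmoothBigO.const 0) (by simpa using smoothBigO_shiftQ hS)
  have hZS := hZ'.comp_sub hQS ((smoothBigO_shiftQ hS').mono_le hμ) hQd
  convert ((hpot.add hkin).sub hZZS).sub hZS using 3 with i x
  simp only [hjRHS, add_zero, smul_eq_mul, inner_add_left, inner_sub_right,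
    real_inner_comm (gradQ (fderiv ℝ (S' i) x)) (gradQ (fderiv ℝ (S i) x))]
  ring

lemma SmoothBigO.zero (η : ι → ℝ≥0) : SmoothBigO (fun (_ : ι) (_ : Phase d) => (0 : ℝ)) η where
  smooth _ := contDiff_const
  bound n := ⟨0, fun i x => by simp⟩

lemma smoothBigO_hjIter (hμ : μ ≤ 1) (hW : SmoothBigO W 1) (hp : ∀ i, IsAnglePeriodic (W i))
    (K : ι → ℕ) (n : ℕ) : SmoothBigO (fun i => hjIter (μ i) (K i) (W i) n) μ := by
  induction n with
  | zero => exact smoothBigO_hjRHS hμ hW (SmoothBigO.zero _) (SmoothBigO.zero _)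
  | succ n ih =>
    have hpn : ∀ i, IsAnglePeriodic (hjIter (μ i) (K i) (W i) n) := fun i =>
      isAnglePeriodic_hjIter (hp i) _ _ n
    exact smoothBigO_hjRHS hμ hW (smoothBigO_homSol ih hpn K) (smoothBigO_resPart ih hpn K)

lemma smoothBigO_hjIter_sub (hμ : μ ≤ 1) (hW : SmoothBigO W 1) (hp : ∀ i, IsAnglePeriodic (W i))
    (K : ι → ℕ) (n : ℕ) :
    SmoothBigO (fun i x => hjIter (μ i) (K i) (W i) (n + 1) x - hjIter (μ i) (K i) (W i) n x)
      (μ ^ (n + 2)) := by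
  have hG := smoothBigO_hjIter hμ hW hp K
  have hGp : ∀ n i, IsAnglePeriodic (hjIter (μ i) (K i) (W i) n) := fun n i =>
    isAnglePeriodic_hjIter (hp i) _ _ n
  have hGc : ∀ n i, Continuous (hjIter (μ i) (K i) (W i) n) := fun n i =>
    ((hG n).smooth i).continuous
  have hS := fun n => smoothBigO_homSol (hG n) (hGp n) K
  have hZ := fun n => smoothBigO_resPart (hG n) (hGp n) K
  induction n with
  | zero =>
    rw [zero_add, pow_two]
    exact smoothBigO_hjRHS_sub hμ hW (hS 0) (SmoothBigO.zero _) (SmoothBigO.zero _)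
      (by simpa only [sub_zero] using hS 0) (by simpa only [sub_zero] using hZ 0)
  | succ n ih =>
    have hpd : ∀ i, IsAnglePeriodic fun x =>
        hjIter (μ i) (K i) (W i) (n + 1) x - hjIter (μ i) (K i) (W i) n x := fun i x k => by
      simp only [hGp (n + 1) i x k, hGp n i x k]
    have hSS : SmoothBigO (fun i x => homSol (K i) (hjIter (μ i) (K i) (W i) (n + 1)) x -
        homSol (K i) (hjIter (μ i) (K i) (W i) n) x) (μ ^ (n + 2)) := by
      simpa only [← homSol_sub _ (hGc (n + 1) _) (hGc n _)] using smoothBigO_homSol ih hpd K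
    have hZZ : SmoothBigO (fun i x => resPart (K i) (hjIter (μ i) (K i) (W i) (n + 1)) x -
        resPart (K i) (hjIter (μ i) (K i) (W i) n) x) (μ ^ (n + 2)) := by
      simpa only [← resPart_sub _ (hGc (n + 1) _) (hGc n _)] using smoothBigO_resPart ih hpd K
    rw [pow_succ' μ (n + 2)]
    exact smoothBigO_hjRHS_sub hμ hW (hS (n + 1)) (hS n) (hZ n) hSS hZZ

lemma exists_hj_solution (hμ : μ ≤ 1) (hW : SmoothBigO W 1) (hp : ∀ i, IsAnglePeriodic (W i))
    (K : ι → ℕ) (n N : ℕ) :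
    ∃ S Z : ι → Phase d → ℝ, SmoothBigO S μ ∧ SmoothBigO Z μ ∧ (∀ i, IsAnglePeriodic (S i)) ∧
      SmoothBigO (fun i => hjDefect (μ i) (W i) (S i) (Z i))
        (fun i => μ i ^ n + ((1 + (K i : ℝ≥0)) ^ N)⁻¹) ∧
      ∀ i, IsResonantTrigPoly (K i) 1 (Z i) := by
  have hG := smoothBigO_hjIter hμ hW hp K n
  have hGp : ∀ i, IsAnglePeriodic (hjIter (μ i) (K i) (W i) n) := fun i =>
    isAnglePeriodic_hjIter (hp i) _ _ n
  refine ⟨fun i => homSol (K i) (hjIter (μ i) (K i) (W i) n),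
    fun i => resPart (K i) (hjIter (μ i) (K i) (W i) n), smoothBigO_homSol hG hGp K,
    smoothBigO_resPart hG hGp K, fun i => isAnglePeriodic_homSol (hGp i) (K i), ?_,
    fun i => isResonantTrigPoly_resPart (hGp i) (K i)⟩
  have htail := ((smoothBigO_fourierTail (smoothBigO_cplx hG)
    (fun i => isAnglePeriodic_cplx (hGp i)) K N).clm Complex.reCLM).mono_le
    (θ := fun i => μ i ^ n + ((1 + (K i : ℝ≥0)) ^ N)⁻¹) fun i =>
      (mul_le_of_le_one_right zero_le (hμ i)).trans (le_add_of_nonneg_left zero_le)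
  have hiter := (smoothBigO_hjIter_sub hμ hW hp K n).mono_le
    (θ := fun i => μ i ^ n + ((1 + (K i : ℝ≥0)) ^ N)⁻¹) fun i =>
      (pow_le_pow_of_le_one zero_le (hμ i) (by omega)).trans (le_add_of_nonneg_right zero_le)
  convert htail.add hiter using 3 with i x
  rw [hjDefect_eq, Complex.reCLM_apply, ← fderiv_homSol_add_sub_resPart hG hGp i (K i) x, hjIter]
  ring

end Estimates

end HamiltonJacobi

/-! ### Canonical transformations from generating functions -/

section NearIdentity

variable {X : Type*} [NormedAddCommGroup X] [NormedSpace ℝ X] {u g : X → X}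

lemma approximatesLinearOn_id_add (hu : Differentiable ℝ u) {c : ℝ≥0}
    (hd : ∀ x, ‖fderiv ℝ u x‖ ≤ c) :
    ApproximatesLinearOn (fun x => x + u x)
      ((ContinuousLinearEquiv.refl ℝ X : X ≃L[ℝ] X) : X →L[ℝ] X) Set.univ c := by
  intro x _ y _
  have hdiff : x + u x - (y + u y) -
      ((ContinuousLinearEquiv.refl ℝ X : X ≃L[ℝ] X) : X →L[ℝ] X) (x - y) = u x - u y := by
    simp only [ContinuousLinearEquiv.coe_refl, ContinuousLinearMap.id_apply]
    abel
  rw [hdiff]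
  exact convex_univ.norm_image_sub_le_of_norm_fderiv_le (𝕜 := ℝ)
    (fun z _ => hu z) (fun z _ => hd z) (Set.mem_univ y) (Set.mem_univ x)

section Inverse

variable [CompleteSpace X]

lemma exists_continuousLinearEquiv_eq_id_add {A : X →L[ℝ] X} (hA : ‖A‖ < 1) :
    ∃ e : X ≃L[ℝ] X, (e : X →L[ℝ] X) = ContinuousLinearMap.id ℝ X + A := by
  refine ⟨ContinuousLinearEquiv.unitsEquiv ℝ X (Units.oneSub (-A) (by rwa [norm_neg])), ?_⟩
  ext y
  simp [ContinuousLinearEquiv.unitsEquiv_apply]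

lemma exists_smooth_inverse_id_add (hu : ContDiff ℝ ∞ u) (hd : ∀ x, ‖fderiv ℝ u x‖ ≤ 1 / 2) :
    ∃ g : X → X, ContDiff ℝ ∞ g ∧ (∀ x, g (x + u x) = x) ∧ ∀ y, g y + u (g y) = y := by
  have hdiff : Differentiable ℝ u := hu.differentiable (by simp)
  have hsmall : Subsingleton X ∨ (1 / 2 : ℝ≥0) <
      ‖((ContinuousLinearEquiv.refl ℝ X).symm : X →L[ℝ] X)‖₊⁻¹ := by
    refine (subsingleton_or_nontrivial X).imp_right fun (_ : Nontrivial X) => ?_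
    have hnorm : ‖((ContinuousLinearEquiv.refl ℝ X).symm : X →L[ℝ] X)‖₊ = 1 := by
      rw [← NNReal.coe_inj]
      exact ContinuousLinearMap.norm_id
    rw [hnorm, inv_one]
    exact NNReal.half_lt_self one_ne_zero
  let h : X ≃ₜ X := (approximatesLinearOn_id_add hdiff (c := 1 / 2)
    (by simpa using hd)).toHomeomorph _ hsmall
  choose e he using fun x => exists_continuousLinearEquiv_eq_id_add (A := fderiv ℝ u x)
    ((hd x).trans_lt one_half_lt_one)
  have hderiv : ∀ x, HasFDerivAt h (e x : X →L[ℝ] X) x := fun x => by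
    rw [he]
    exact (hasFDerivAt_id x).add (hdiff x).hasFDerivAt
  exact ⟨h.symm, h.contDiff_symm hderiv (contDiff_id.add hu), h.symm_apply_apply,
    h.apply_symm_apply⟩

end Inverse

section Bounds

variable (hu : ContDiff ℝ ∞ u) (hg : ContDiff ℝ ∞ g) (hr : ∀ y, g y + u (g y) = y)
include hu hg hr

lemma fderiv_inverse_add (y : X) :
    fderiv ℝ g y + (fderiv ℝ u (g y)).comp (fderiv ℝ g y) = ContinuousLinearMap.id ℝ X := by
  have hgd := (hg.differentiable (by simp) y).hasFDerivAt
  have hderiv : HasFDerivAt (fun y => g y + u (g y)) _ y :=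
    hgd.add ((hu.differentiable (by simp) _).hasFDerivAt.comp y hgd)
  rw [funext hr] at hderiv
  exact hderiv.unique (hasFDerivAt_id y)

lemma fderiv_inverse_add_apply (y z : X) :
    fderiv ℝ g y z + fderiv ℝ u (g y) (fderiv ℝ g y z) = z :=
  DFunLike.congr_fun (fderiv_inverse_add hu hg hr y) z

lemma fderiv_fderiv_inverse_add (y z : X) :
    fderiv ℝ (fderiv ℝ g) y z + ((fderiv ℝ u (g y)).comp (fderiv ℝ (fderiv ℝ g) y z) +
      (fderiv ℝ (fderiv ℝ u) (g y) (fderiv ℝ g y z)).comp (fderiv ℝ g y)) = 0 := by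
  have hg' := ((hg.fderiv_right (m := ∞) (by simp)).differentiable (by simp) y).hasFDerivAt
  have hu' : HasFDerivAt (fun y => fderiv ℝ u (g y))
      ((fderiv ℝ (fderiv ℝ u) (g y)).comp (fderiv ℝ g y)) y :=
    ((hu.fderiv_right (m := ∞) (by simp)).differentiable (by simp) _).hasFDerivAt.comp y
      (hg.differentiable (by simp) y).hasFDerivAt
  have hderiv := hg'.add (hu'.clm_comp hg')
  have hconst : fderiv ℝ g + (fun y => (fderiv ℝ u (g y)).comp (fderiv ℝ g y)) =
      fun _ => ContinuousLinearMap.id ℝ X := funext (fderiv_inverse_add hu hg hr)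
  rw [hconst] at hderiv
  exact DFunLike.congr_fun (hderiv.unique (hasFDerivAt_const _ _)) z

variable (hd : ∀ x, ‖fderiv ℝ u x‖ ≤ 1 / 2)
include hd

lemma norm_fderiv_inverse_le (y : X) : ‖fderiv ℝ g y‖ ≤ 2 := by
  refine ContinuousLinearMap.opNorm_le_bound _ zero_le_two fun z => ?_
  have hz := eq_sub_of_add_eq (fderiv_inverse_add_apply hu hg hr y z)
  have hle : ‖fderiv ℝ g y z‖ ≤ ‖z‖ + 1 / 2 * ‖fderiv ℝ g y z‖ := by
    calc ‖fderiv ℝ g y z‖ = ‖z - fderiv ℝ u (g y) (fderiv ℝ g y z)‖ := by rw [← hz]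
      _ ≤ ‖z‖ + ‖fderiv ℝ u (g y) (fderiv ℝ g y z)‖ := norm_sub_le _ _
      _ ≤ ‖z‖ + 1 / 2 * ‖fderiv ℝ g y z‖ := by
        gcongr
        exact ContinuousLinearMap.le_of_opNorm_le _ (hd _) _
  linarith

variable {B : ℝ} (hB : ∀ x, ‖fderiv ℝ (fderiv ℝ u) x‖ ≤ B)
include hB

lemma norm_fderiv_fderiv_inverse_le (y : X) : ‖fderiv ℝ (fderiv ℝ g) y‖ ≤ 8 * B := by
  have hB0 : 0 ≤ B := (norm_nonneg _).trans (hB y)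
  have hg2 := norm_fderiv_inverse_le hu hg hr hd y
  refine ContinuousLinearMap.opNorm_le_bound _ (by positivity) fun z => ?_
  set Q := fderiv ℝ (fderiv ℝ g) y z
  have hQ : ‖Q‖ ≤ 1 / 2 * ‖Q‖ + B * (2 * ‖z‖) * 2 := by
    calc ‖Q‖ = ‖(fderiv ℝ u (g y)).comp Q +
          (fderiv ℝ (fderiv ℝ u) (g y) (fderiv ℝ g y z)).comp (fderiv ℝ g y)‖ := by
            rw [← norm_neg, neg_eq_of_add_eq_zero_right (fderiv_fderiv_inverse_add hu hg hr y z)]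
      _ ≤ ‖fderiv ℝ u (g y)‖ * ‖Q‖ +
          ‖fderiv ℝ (fderiv ℝ u) (g y) (fderiv ℝ g y z)‖ * ‖fderiv ℝ g y‖ :=
        (norm_add_le _ _).trans (add_le_add (ContinuousLinearMap.opNorm_comp_le _ _)
          (ContinuousLinearMap.opNorm_comp_le _ _))
      _ ≤ 1 / 2 * ‖Q‖ + B * (2 * ‖z‖) * 2 := by
        gcongr
        · exact hd _
        · exact ContinuousLinearMap.le_of_opNorm_le_of_le _ (hB _)
            (ContinuousLinearMap.le_of_opNorm_le _ hg2 z)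
  linarith

lemma norm_iteratedFDeriv_comp_inverse_le {F : Type*} [NormedAddCommGroup F] [NormedSpace ℝ F]
    {E : X → F} (hE : ContDiff ℝ ∞ E) {a : ℝ} (ha : ∀ n ≤ 2, ∀ x, ‖iteratedFDeriv ℝ n E x‖ ≤ a)
    {n : ℕ} (hn : n ≤ 2) (y : X) :
    ‖iteratedFDeriv ℝ n (fun y => E (g y)) y‖ ≤ 2 * (2 + 8 * B) ^ 2 * a := by
  have hB0 : 0 ≤ B := (norm_nonneg _).trans (hB y)
  have ha0 : 0 ≤ a := (norm_nonneg _).trans (ha 0 (by omega) y)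
  have hgbound : ∀ i, 1 ≤ i → i ≤ n → ‖iteratedFDeriv ℝ i g y‖ ≤ (2 + 8 * B) ^ i := by
    intro i h1i hi
    obtain rfl | rfl : i = 1 ∨ i = 2 := by omega
    · rw [norm_iteratedFDeriv_one, pow_one]
      linarith [norm_fderiv_inverse_le hu hg hr hd y]
    · rw [← norm_iteratedFDeriv_fderiv, norm_iteratedFDeriv_one]
      nlinarith [norm_fderiv_fderiv_inverse_le hu hg hr hd hB y]
  have hfact : (n.factorial : ℝ) ≤ 2 := by exact_mod_cast Nat.factorial_le hn
  have hpow : (2 + 8 * B) ^ n ≤ (2 + 8 * B) ^ 2 := pow_le_pow_right₀ (by linarith) hn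
  calc ‖iteratedFDeriv ℝ n (fun y => E (g y)) y‖ ≤ n.factorial * a * (2 + 8 * B) ^ n :=
        norm_iteratedFDeriv_comp_le hE hg (by exact_mod_cast le_top) y
          (fun i hi => ha i (hi.trans hn) _) hgbound
    _ ≤ 2 * a * (2 + 8 * B) ^ 2 := by gcongr
    _ = 2 * (2 + 8 * B) ^ 2 * a := by ring

end Bounds

end NearIdentity

section Canonical

variable {d : ℕ} {S : Phase d → ℝ}

lemma contDiff_shiftP (hS : ContDiff ℝ ∞ S) : ContDiff ℝ ∞ (shiftP S) :=
  ((ContinuousLinearMap.inl ℝ (Vec d) (Vec d)).comp gradQ).contDiff.comp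
    (hS.fderiv_right (by simp))

lemma contDiff_shiftQ (hS : ContDiff ℝ ∞ S) : ContDiff ℝ ∞ (shiftQ S) :=
  ((ContinuousLinearMap.inr ℝ (Vec d) (Vec d)).comp gradP).contDiff.comp
    (hS.fderiv_right (by simp))

lemma hasFDerivAt_fderiv (hS : ContDiff ℝ ∞ S) (x : Phase d) :
    HasFDerivAt (fderiv ℝ S) (fderiv ℝ (fderiv ℝ S) x) x :=
  ((hS.fderiv_right (m := ∞) (by simp)).differentiable (by simp) x).hasFDerivAt

lemma fderiv_shiftP_apply (hS : ContDiff ℝ ∞ S) (x a : Phase d) :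
    fderiv ℝ (shiftP S) x a = (gradQ (fderiv ℝ (fderiv ℝ S) x a), 0) := by
  have hderiv : HasFDerivAt (shiftP S) _ x :=
    ((ContinuousLinearMap.inl ℝ (Vec d) (Vec d)).comp gradQ).hasFDerivAt.comp x
      (hasFDerivAt_fderiv hS x)
  rw [hderiv.fderiv]
  rfl

lemma fderiv_shiftQ_apply (hS : ContDiff ℝ ∞ S) (x a : Phase d) :
    fderiv ℝ (shiftQ S) x a = (0, gradP (fderiv ℝ (fderiv ℝ S) x a)) := by
  have hderiv : HasFDerivAt (shiftQ S) _ x :=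
    ((ContinuousLinearMap.inr ℝ (Vec d) (Vec d)).comp gradP).hasFDerivAt.comp x
      (hasFDerivAt_fderiv hS x)
  rw [hderiv.fderiv]
  rfl

lemma symplForm_shiftP_eq_symplForm_shiftQ (hS : ContDiff ℝ ∞ S) (x a b : Phase d) :
    symplForm (a + fderiv ℝ (shiftP S) x a) (b + fderiv ℝ (shiftP S) x b) =
      symplForm (a + fderiv ℝ (shiftQ S) x a) (b + fderiv ℝ (shiftQ S) x b) := by
  have hsymm : fderiv ℝ (fderiv ℝ S) x a b = fderiv ℝ (fderiv ℝ S) x b a :=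
    (hS.contDiffAt.isSymmSndFDerivAt (by simpa using ENat.LEInfty.out)) a b
  simp only [fderiv_shiftP_apply hS, fderiv_shiftQ_apply hS]
  set H := fderiv ℝ (fderiv ℝ S) x
  have ha : H b a = H b (a.1, 0) + H b (0, a.2) := by rw [← map_add]; simp
  have hb : H a b = H a (b.1, 0) + H a (0, b.2) := by rw [← map_add]; simp
  simp only [symplForm, Prod.fst_add, Prod.snd_add, add_zero, inner_add_left, inner_add_right,
    inner_gradQ, inner_gradP]
  rw [real_inner_comm (gradQ (H b)) a.2, real_inner_comm (gradP (H b)) a.1, inner_gradQ,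
    inner_gradP]
  linarith

lemma inverse_add_latticeVec {u g : Phase d → Phase d} (hu : IsAnglePeriodic u)
    (hl : ∀ x, g (x + u x) = x) (hr : ∀ y, g y + u (g y) = y) (x : Phase d) (k : Fin d → ℤ) :
    g (x + (0, latticeVec k)) = g x + (0, latticeVec k) := by
  have h := hl (g x + (0, latticeVec k))
  rwa [hu, add_right_comm, hr] at h

lemma isAnglePeriodic_shiftP (hp : IsAnglePeriodic S) : IsAnglePeriodic (shiftP S) := fun x k => by
  simp only [shiftP, hp.fderiv_right x k]

lemma isAnglePeriodic_shiftQ (hp : IsAnglePeriodic S) : IsAnglePeriodic (shiftQ S) := fun x k => by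
  simp only [shiftQ, hp.fderiv_right x k]

lemma symplForm_fderiv_shiftP_comp_inverse (hS : ContDiff ℝ ∞ S) {g : Phase d → Phase d}
    (hg : ContDiff ℝ ∞ g) (hr : ∀ x, g x + shiftQ S (g x) = x) (x u v : Phase d) :
    symplForm (fderiv ℝ (fun x => g x + shiftP S (g x)) x u)
      (fderiv ℝ (fun x => g x + shiftP S (g x)) x v) = symplForm u v := by
  have hgd := (hg.differentiable (by simp) x).hasFDerivAt
  have hderiv : HasFDerivAt (fun x => g x + shiftP S (g x)) _ x :=
    hgd.add (((contDiff_shiftP hS).differentiable (by simp) _).hasFDerivAt.comp x hgd)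
  have hpull := symplForm_shiftP_eq_symplForm_shiftQ hS (g x) (fderiv ℝ g x u) (fderiv ℝ g x v)
  rw [fderiv_inverse_add_apply (contDiff_shiftQ hS) hg hr,
    fderiv_inverse_add_apply (contDiff_shiftQ hS) hg hr] at hpull
  rw [hderiv.fderiv]
  exact hpull

/-- The canonical transformation with generating function `S`: it sends `(p, q + ∂_p S)` to
`(p + ∂_q S, q)`. -/
lemma exists_canonical (hS : ContDiff ℝ ∞ S) (hp : IsAnglePeriodic S)
    (hP : ∀ x, ‖fderiv ℝ (shiftP S) x‖ ≤ 1 / 2) (hQ : ∀ x, ‖fderiv ℝ (shiftQ S) x‖ ≤ 1 / 2) :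
    ∃ T g : Phase d → Phase d, IsCanonical T ∧ ContDiff ℝ ∞ g ∧
      (∀ x, g x + shiftQ S (g x) = x) ∧ ∀ x, T x = g x + shiftP S (g x) := by
  obtain ⟨g, hg, hgl, hgr⟩ := exists_smooth_inverse_id_add (contDiff_shiftQ hS) hQ
  obtain ⟨h, hh, hhl, hhr⟩ := exists_smooth_inverse_id_add (contDiff_shiftP hS) hP
  refine ⟨fun x => g x + shiftP S (g x), g, ⟨hg.add ((contDiff_shiftP hS).comp hg), ?_, ?_,
    symplForm_fderiv_shiftP_comp_inverse hS hg hgr⟩, hg, hgr, fun x => rfl⟩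
  · intro p q k
    have hlattice : ((p, q + latticeVec k) : Phase d) = (p, q) + (0, latticeVec k) := by simp
    simp only [hlattice, inverse_add_latticeVec (isAnglePeriodic_shiftQ hp) hgl hgr,
      isAnglePeriodic_shiftP hp _ k]
    rw [add_right_comm]
  · exact ⟨fun x => h x + shiftQ S (h x), hh.add ((contDiff_shiftQ hS).comp hh),
      fun x => by simp only [hhl, hgr], fun x => by simp only [hgl, hhr]⟩

end Canonical

/-! ### Dynamics of Hamiltonians in normal form -/

section GlobalFlow

variable {X : Type*} [NormedAddCommGroup X] {v : X → X} {L : ℝ≥0}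

-- The speed on the ball of radius `a = ‖v x‖ + 1` is at most `(1 + L) * a`, so the time of
-- existence does not depend on the initial point.
lemma isPicardLindelof_of_lipschitzWith (hL : LipschitzWith L v) {τ : ℝ} (hτ : 0 ≤ τ)
    (hτL : (1 + L) * τ ≤ 1) (x : X) :
    IsPicardLindelof (fun _ => v) (tmin := -τ) (tmax := τ) ⟨0, by simp [hτ]⟩ x
      (‖v x‖₊ + 1) 0 ((1 + L) * (‖v x‖₊ + 1)) L where
  lipschitzOnWith _ _ := hL.lipschitzOnWith
  continuousOn _ _ := continuousOn_const
  norm_le t _ y hy := by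
    have hlip : ‖v y - v x‖ ≤ L * (‖v x‖ + 1) := by
      refine (hL.norm_sub_le y x).trans ?_
      gcongr
      simpa [dist_eq_norm] using hy
    have htri := norm_le_norm_add_norm_sub' (v y) (v x)
    push_cast
    linarith
  mul_max_le := by
    push_cast
    simp only [sub_zero, zero_sub, neg_neg, max_self]
    calc (1 + (L : ℝ)) * (‖v x‖ + 1) * τ = ((1 + L) * τ) * (‖v x‖ + 1) := by ring
      _ ≤ ‖v x‖ + 1 := mul_le_of_le_one_left (by positivity) hτL

variable [NormedSpace ℝ X] [CompleteSpace X]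

lemma exists_global_solution (hv : ContDiff ℝ 1 v) (hL : LipschitzWith L v) (x₀ : X) :
    ∃ γ : ℝ → X, γ 0 = x₀ ∧ ∀ t, HasDerivAt γ (v (γ t)) t := by
  let I := modelWithCornersSelf ℝ X
  let τ : ℝ := (1 + (L : ℝ))⁻¹
  have hτ : 0 < τ := by positivity
  have hloc : ∀ x : X, ∃ γ : ℝ → X, γ 0 = x ∧
      IsMIntegralCurveOn (I := I) γ (v : (x : X) → TangentSpace I x) (Set.Ioo (-τ) τ) := fun x => by
    obtain ⟨γ, h0, hγ⟩ := (isPicardLindelof_of_lipschitzWith hL hτ.le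
      (mul_inv_cancel₀ (by positivity)).le x).exists_eq_forall_mem_Icc_hasDerivWithinAt₀
    exact ⟨γ, h0, fun t ht => ((hγ t (Set.Ioo_subset_Icc_self ht)).hasFDerivWithinAt.mono
      Set.Ioo_subset_Icc_self).hasMFDerivWithinAt⟩
  have hvm : ContMDiff I I.tangent 1 (fun x => (⟨x, v x⟩ : TangentBundle I X)) :=
    contMDiff_vectorSpace_iff_contDiff.2 hv
  obtain ⟨γ, h0, hγ⟩ := exists_isMIntegralCurve_of_isMIntegralCurveOn hvm hτ hloc x₀
  refine ⟨γ, h0, fun t => ?_⟩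
  have hderiv : HasFDerivAt γ ((ContinuousLinearMap.id ℝ ℝ).smulRight (v (γ t))) t :=
    hasMFDerivAt_iff_hasFDerivAt.1 (hγ t)
  simpa using hderiv.hasDerivAt

end GlobalFlow

section Dynamics

variable {d : ℕ} {Z : Phase d → ℝ}

lemma hamField_eq {H : Phase d → ℝ} {x : Phase d} (hH : DifferentiableAt ℝ H x) :
    hamField H x = (-gradQ (fderiv ℝ H x), gradP (fderiv ℝ H x)) := by
  have hq : HasFDerivAt (fun q => H (x.1, q))
      ((fderiv ℝ H x).comp (ContinuousLinearMap.inr ℝ (Vec d) (Vec d))) x.2 :=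
    HasFDerivAt.comp (g := H) x.2 hH.hasFDerivAt (hasFDerivAt_prodMk_right x.1 x.2)
  have hp : HasFDerivAt (fun p => H (p, x.2))
      ((fderiv ℝ H x).comp (ContinuousLinearMap.inl ℝ (Vec d) (Vec d))) x.1 :=
    HasFDerivAt.comp (g := H) x.1 hH.hasFDerivAt (hasFDerivAt_prodMk_left x.1 x.2)
  rw [hamField, gradient, gradient, hq.fderiv, hp.fderiv]
  rfl

lemma hasFDerivAt_freeH (x : Phase d) :
    HasFDerivAt freeH ((innerSL ℝ x.1).comp (ContinuousLinearMap.fst ℝ (Vec d) (Vec d))) x := by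
  rw [funext freeH_eq]
  have hfst : HasFDerivAt (fun x : Phase d => x.1) _ x := hasFDerivAt_fst (𝕜 := ℝ)
  refine ((hfst.inner ℝ hfst).mul_const (2 : ℝ)⁻¹).congr_fderiv
    (ContinuousLinearMap.ext fun v => ?_)
  simp only [smul_apply, ContinuousLinearMap.comp_apply, ContinuousLinearMap.prod_apply,
    fderivInnerCLM_apply, innerSL_apply_apply, smul_eq_mul, real_inner_comm x.1]
  ring

lemma hamField_freeH_add {x : Phase d} (hZ : DifferentiableAt ℝ Z x) :
    hamField (fun x => freeH x + Z x) x =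
      (-gradQ (fderiv ℝ Z x), x.1 + gradP (fderiv ℝ Z x)) := by
  have hderiv : HasFDerivAt (fun x => freeH x + Z x) _ x :=
    (hasFDerivAt_freeH x).add hZ.hasFDerivAt
  have hq : gradQ ((innerSL ℝ x.1).comp (ContinuousLinearMap.fst ℝ (Vec d) (Vec d))) = 0 :=
    ext_inner_right ℝ fun v => by simp [inner_gradQ]
  have hp : gradP ((innerSL ℝ x.1).comp (ContinuousLinearMap.fst ℝ (Vec d) (Vec d))) = x.1 :=
    ext_inner_right ℝ fun v => by simp [inner_gradP]
  rw [hamField_eq hderiv.differentiableAt, hderiv.fderiv, map_add, map_add, hq, hp, zero_add]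

lemma exists_solution (hZ : ContDiff ℝ ∞ Z) {B : ℝ} (hB : ∀ x, ‖iteratedFDeriv ℝ 2 Z x‖ ≤ B)
    (x₀ : Phase d) : ∃ γ : ℝ → Phase d, γ 0 = x₀ ∧ IsSolution (fun x => freeH x + Z x) γ := by
  have hZ' : ContDiff ℝ ∞ (fderiv ℝ Z) := hZ.fderiv_right (by simp)
  let A : (Phase d →L[ℝ] ℝ) →L[ℝ] Phase d := (-gradQ).prod gradP
  let J : Phase d →L[ℝ] Phase d := (ContinuousLinearMap.inr ℝ (Vec d) (Vec d)).comp
    (ContinuousLinearMap.fst ℝ (Vec d) (Vec d))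
  have hfield : hamField (fun x => freeH x + Z x) = fun x => J x + A (fderiv ℝ Z x) := by
    funext x
    rw [hamField_freeH_add (hZ.differentiable (by simp) x)]
    simp [A, J]
  have hlip : LipschitzWith B.toNNReal (fderiv ℝ Z) := by
    refine lipschitzWith_of_nnnorm_fderiv_le (𝕜 := ℝ) (hZ'.differentiable (by simp)) fun x => ?_
    rw [← NNReal.coe_le_coe, coe_nnnorm, ← norm_iteratedFDeriv_one, norm_iteratedFDeriv_fderiv]
    exact (hB x).trans (Real.le_coe_toNNReal B)
  have hsmooth : ContDiff ℝ 1 fun x => J x + A (fderiv ℝ Z x) :=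
    (J.contDiff.add (A.contDiff.comp hZ')).of_le (by simp)
  simp only [IsSolution, hfield]
  exact exists_global_solution hsmooth (J.lipschitz.add (A.lipschitz.comp hlip)) x₀

variable {δ β ε : ℝ}

lemma IsNormalForm.apply_add_angle (hn : IsNormalForm δ β ε Z) {p v : Vec d}
    (hv : v ∈ (resonantSpan (cutoff β ε) (ε ^ δ) p)ᗮ) (q : Vec d) : Z (p, q + v) = Z (p, q) := by
  obtain ⟨c, hc, hres⟩ := hn
  rw [← Complex.ofReal_inj, hc, hc]
  refine Finset.sum_congr rfl fun k hk => ?_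
  rcases eq_or_ne (c k p) 0 with hck | hck
  · rw [hck, zero_mul, zero_mul]
  have hkv : dotInt k v = 0 := by
    rcases eq_or_ne k 0 with rfl | hk0
    · simp [dotInt]
    · rw [← inner_intVec]
      exact (Submodule.mem_orthogonal _ _).1 hv _
        (Submodule.subset_span ⟨k, ⟨hk, hres k hk hk0 p hck⟩, rfl⟩)
  rw [← inner_intVec, inner_add_right, inner_intVec, inner_intVec, hkv, add_zero]

lemma IsNormalForm.gradQ_mem_resonantSpan (hn : IsNormalForm δ β ε Z) {x : Phase d}
    (hZ : DifferentiableAt ℝ Z x) :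
    gradQ (fderiv ℝ Z x) ∈ resonantSpan (cutoff β ε) (ε ^ δ) x.1 := by
  rw [← Submodule.orthogonal_orthogonal (resonantSpan (cutoff β ε) (ε ^ δ) x.1),
    Submodule.mem_orthogonal']
  intro v hv
  have hline : HasDerivAt (fun s : ℝ => x + s • ((0 : Vec d), v)) (0, v) 0 := by
    simpa using ((hasDerivAt_id (0 : ℝ)).smul_const ((0 : Vec d), v)).const_add x
  have hderiv : HasDerivAt (fun s : ℝ => Z (x + s • ((0 : Vec d), v)))
      (fderiv ℝ Z x (0, v)) 0 :=
    HasFDerivAt.comp_hasDerivAt (l := Z) 0 (by simpa using hZ.hasFDerivAt) hline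
  have hconst : (fun s : ℝ => Z (x + s • ((0 : Vec d), v))) = fun _ => Z x := by
    funext s
    have hx : x + s • ((0 : Vec d), v) = (x.1, x.2 + s • v) := by ext <;> simp
    rw [hx, hn.apply_add_angle (Submodule.smul_mem _ s hv)]
  rw [hconst] at hderiv
  rw [inner_gradQ]
  exact hderiv.unique (hasDerivAt_const _ _)

end Dynamics

/-! ### Scaling of the actions -/

section Scaling

variable {d : ℕ} {r : ℝ}

/-- The scaling `(p, q) ↦ (r p, q)`, which turns resonance widths `r` into `1`. -/
def scale (r : ℝ) : Phase d →L[ℝ] Phase d :=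
  (r • ContinuousLinearMap.id ℝ (Vec d)).prodMap (ContinuousLinearMap.id ℝ (Vec d))

lemma scale_apply (r : ℝ) (x : Phase d) : scale r x = (r • x.1, x.2) := rfl

lemma scale_scale {s : ℝ} (h : r * s = 1) (x : Phase d) : scale r (scale s x) = x := by
  simp [scale_apply, smul_smul, h]

lemma scale_add_angle (r : ℝ) (x : Phase d) (v : Vec d) :
    scale r (x + (0, v)) = scale r x + (0, v) := by
  simp [scale_apply]

lemma isAnglePeriodic_comp_scale {V : Phase d → ℝ} (hV : AnglePeriodic V) (r : ℝ) :
    IsAnglePeriodic fun x => V (scale r x) := fun x k => by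
  have hV' := hV (r • x.1) x.2 k
  simpa [scale_apply] using hV'

lemma freeH_scale (r : ℝ) (x : Phase d) : freeH (scale r x) = r ^ 2 * freeH x := by
  simp only [freeH_eq, scale_apply, inner_smul_left, inner_smul_right, RCLike.conj_to_real]
  ring

lemma symplForm_scale (r : ℝ) (u v : Phase d) :
    symplForm (scale r u) (scale r v) = r * symplForm u v := by
  simp only [symplForm, scale_apply, inner_smul_left, inner_smul_right, RCLike.conj_to_real]
  ring

lemma norm_scale_le {c : ℝ} (h : |r| ≤ c) (hc : 1 ≤ c) :
    ‖(scale r : Phase d →L[ℝ] Phase d)‖ ≤ c := by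
  refine ContinuousLinearMap.opNorm_le_bound _ (by linarith) fun x => ?_
  rw [scale_apply, Prod.norm_def, norm_smul, Real.norm_eq_abs]
  exact max_le (mul_le_mul h (norm_fst_le x) (norm_nonneg _) (by linarith))
    ((norm_snd_le x).trans (le_mul_of_one_le_left (norm_nonneg _) hc))

variable {F : Type*} [NormedAddCommGroup F] [NormedSpace ℝ F] {f : Phase d → F}

lemma norm_iteratedFDeriv_comp_scale_le (hf : ContDiff ℝ ∞ f) {c : ℝ} (h : |r| ≤ c) (hc : 1 ≤ c)
    (n : ℕ) (x : Phase d) :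
    ‖iteratedFDeriv ℝ n (fun x => f (scale r x)) x‖ ≤
      ‖iteratedFDeriv ℝ n f (scale r x)‖ * c ^ n := by
  have hcomp : iteratedFDeriv ℝ n (fun x => f (scale r x)) x = _ :=
    (scale r).iteratedFDeriv_comp_right hf x (i := n) (by exact_mod_cast le_top)
  rw [hcomp]
  refine (ContinuousMultilinearMap.norm_compContinuousLinearMap_le _ _).trans ?_
  rw [Finset.prod_const, Finset.card_univ, Fintype.card_fin]
  gcongr
  exact norm_scale_le h hc

lemma norm_iteratedFDeriv_sq_smul_comp_scale_inv_le (hf : ContDiff ℝ ∞ f) (h0 : 0 < r)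
    (h1 : r ≤ 1) {a : ℝ} {n : ℕ} (hn : n ≤ 2) (ha : ∀ x, ‖iteratedFDeriv ℝ n f x‖ ≤ a)
    (x : Phase d) : ‖iteratedFDeriv ℝ n (fun x => r ^ 2 • f (scale r⁻¹ x)) x‖ ≤ a := by
  have hcomp : ContDiff ℝ ∞ fun x => f (scale r⁻¹ x) := hf.comp (scale r⁻¹).contDiff
  have hsmul : iteratedFDeriv ℝ n (fun x => r ^ 2 • f (scale r⁻¹ x)) x =
      r ^ 2 • iteratedFDeriv ℝ n (fun x => f (scale r⁻¹ x)) x :=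
    iteratedFDeriv_const_smul_apply (a := r ^ 2) (f := fun x => f (scale r⁻¹ x))
      (hcomp.contDiffAt.of_le (by exact_mod_cast le_top))
  have hinv : 1 ≤ r⁻¹ := (one_le_inv₀ h0).2 h1
  have ha0 : 0 ≤ a := (norm_nonneg _).trans (ha x)
  rw [hsmul, norm_smul, Real.norm_eq_abs, abs_of_pos (by positivity)]
  calc r ^ 2 * ‖iteratedFDeriv ℝ n (fun x => f (scale r⁻¹ x)) x‖
      ≤ r ^ 2 * (‖iteratedFDeriv ℝ n f (scale r⁻¹ x)‖ * r⁻¹ ^ n) := by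
        gcongr
        exact norm_iteratedFDeriv_comp_scale_le hf (abs_of_pos (by positivity)).le hinv n x
    _ ≤ r ^ 2 * (a * r⁻¹ ^ 2) := by
        gcongr
        exact ha _
    _ = a := by field_simp

lemma isCanonical_conj_scale {T : Phase d → Phase d} (hT : IsCanonical T) (hr : 0 < r) :
    IsCanonical fun x => scale r (T (scale r⁻¹ x)) := by
  have hr1 : r * r⁻¹ = 1 := mul_inv_cancel₀ hr.ne'
  have hr2 : r⁻¹ * r = 1 := inv_mul_cancel₀ hr.ne'
  obtain ⟨S, hS, hl, hS'⟩ := hT.smooth_inverse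
  refine ⟨(scale r).contDiff.comp (hT.smooth.comp (scale r⁻¹).contDiff), fun p q k => ?_,
    ⟨fun x => scale r (S (scale r⁻¹ x)), (scale r).contDiff.comp (hS.comp (scale r⁻¹).contDiff),
      fun x => ?_, fun x => ?_⟩, fun x u v => ?_⟩
  · rw [scale_apply r⁻¹, hT.equivariant, scale_add_angle]
    rfl
  · simp only [scale_scale hr2, hl _, scale_scale hr1]
  · simp only [scale_scale hr2, hS' _, scale_scale hr1]
  · have hderiv : HasFDerivAt (fun x => scale r (T (scale r⁻¹ x)))
        ((scale r).comp ((fderiv ℝ T (scale r⁻¹ x)).comp (scale r⁻¹))) x :=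
      (scale r).hasFDerivAt.comp x
        ((hT.smooth.differentiable (by simp) _).hasFDerivAt.comp x (scale r⁻¹).hasFDerivAt)
    rw [hderiv.fderiv]
    simp only [ContinuousLinearMap.comp_apply]
    rw [symplForm_scale, hT.symplectic, symplForm_scale, ← mul_assoc, hr1, one_mul]

lemma smoothBigO_comp_scale {ι : Type*} {V : Phase d → ℝ} (hV : ContDiff ℝ ∞ V)
    (hVb : BoundedDerivs V) {r : ι → ℝ} (hr : ∀ i, |r i| ≤ 1) :
    SmoothBigO (fun i x => V (scale (r i) x)) 1 where
  smooth i := hV.comp (scale (r i)).contDiff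
  bound n := by
    obtain ⟨C, hC⟩ := hVb n
    refine ⟨C.toNNReal, fun i x => ?_⟩
    have hle := norm_iteratedFDeriv_comp_scale_le hV (hr i) le_rfl n x
    rw [one_pow, mul_one] at hle
    simpa using hle.trans ((hC _).trans (Real.le_coe_toNNReal C))

lemma IsResonantTrigPoly.conj_scale {K : ℕ} {Z : Phase d → ℝ} (hZ : IsResonantTrigPoly K 1 Z)
    (hr : 0 < r) : IsResonantTrigPoly K r fun x => r ^ 2 • Z (scale r⁻¹ x) := by
  obtain ⟨c, hc, hres⟩ := hZ
  refine ⟨fun k p => (r ^ 2 : ℝ) * c k (r⁻¹ • p), fun p q => ?_, fun k p hk => ?_⟩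
  · simp only [scale_apply, smul_eq_mul, Complex.ofReal_mul, hc, Finset.mul_sum, mul_assoc]
  · have hle := hres k _ (right_ne_zero_of_mul hk)
    rwa [← inner_intVec, inner_smul_right, inner_intVec, abs_mul, abs_of_pos (inv_pos.2 hr),
      inv_mul_le_iff₀ hr, mul_one] at hle

end Scaling

/-! ### The normal form and the confinement of the actions -/

section NormalForm

variable {d : ℕ} {V : Phase d → ℝ}

lemma perturbedH_scale_sub {r : ℝ} (hr : 0 < r) (μ : ℝ) (V Z : Phase d → ℝ) (x y : Phase d) :
    perturbedH (r ^ 2 * μ) V (scale r y) - (freeH x + r ^ 2 • Z (scale r⁻¹ x)) =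
      r ^ 2 • (freeH y + μ * V (scale r y) - (freeH (scale r⁻¹ x) + Z (scale r⁻¹ x))) := by
  rw [perturbedH, freeH_scale, freeH_scale, smul_eq_mul, smul_eq_mul]
  field_simp

lemma exists_canonical_of_hjDefect {r : ℝ} {μ : ℝ≥0} (hr : 0 < r) (hr1 : r ≤ 1)
    {S Z : Phase d → ℝ} (hS : ContDiff ℝ ∞ S) (hp : IsAnglePeriodic S)
    (hE : ContDiff ℝ ∞ (hjDefect μ (fun x => V (scale r x)) S Z))
    (hP : ∀ x, ‖fderiv ℝ (shiftP S) x‖ ≤ 1 / 2) (hQ : ∀ x, ‖fderiv ℝ (shiftQ S) x‖ ≤ 1 / 2)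
    {s B a : ℝ} (hs : ∀ x, ‖shiftP S x‖ ≤ s) (hB : ∀ x, ‖fderiv ℝ (fderiv ℝ (shiftQ S)) x‖ ≤ B)
    (ha : ∀ n ≤ 2, ∀ x, ‖iteratedFDeriv ℝ n (hjDefect μ (fun x => V (scale r x)) S Z) x‖ ≤ a) :
    ∃ T : Phase d → Phase d, IsCanonical T ∧ (∀ x, ‖(T x).1 - x.1‖ ≤ r * s) ∧
      C2NormLE (fun x => perturbedH (r ^ 2 * μ) V (T x) - (freeH x + r ^ 2 • Z (scale r⁻¹ x)))
        (2 * (2 + 8 * B) ^ 2 * a) := by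
  obtain ⟨T, g, hT, hg, hgr, hTg⟩ := exists_canonical hS hp hP hQ
  refine ⟨fun x => scale r (T (scale r⁻¹ x)), isCanonical_conj_scale hT hr, fun x => ?_,
    fun n hn x => ?_⟩
  · have hg1 : (g (scale r⁻¹ x)).1 = r⁻¹ • x.1 := by
      simpa [shiftQ, scale_apply] using congrArg Prod.fst (hgr (scale r⁻¹ x))
    have hmove : (scale r (T (scale r⁻¹ x))).1 - x.1 = r • (shiftP S (g (scale r⁻¹ x))).1 := by
      rw [hTg, scale_apply, Prod.fst_add, hg1, smul_add, smul_inv_smul₀ hr.ne',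
        add_sub_cancel_left]
    rw [hmove, norm_smul, Real.norm_eq_abs, abs_of_pos hr]
    gcongr
    exact (norm_fst_le _).trans (hs _)
  · have hdefect : (fun x => perturbedH (r ^ 2 * μ) V (scale r (T (scale r⁻¹ x))) -
        (freeH x + r ^ 2 • Z (scale r⁻¹ x))) = fun x => r ^ 2 •
          (fun y => hjDefect μ (fun x => V (scale r x)) S Z (g y)) (scale r⁻¹ x) := by
      funext x
      rw [perturbedH_scale_sub hr]
      simp only [hjDefect]
      rw [← hTg, hgr]
    rw [hdefect]
    exact norm_iteratedFDeriv_sq_smul_comp_scale_inv_le (hE.comp hg) hr hr1 hn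
      (norm_iteratedFDeriv_comp_inverse_le (contDiff_shiftQ hS) hg hgr hQ hB hE ha hn) x

lemma exists_shift_bounds {ι : Type*} {S : ι → Phase d → ℝ} {μ : ι → ℝ≥0}
    (hS : SmoothBigO S μ) :
    ∃ C η : ℝ, 0 ≤ C ∧ 0 < η ∧ ∀ i x, ‖shiftP (S i) x‖ ≤ C * μ i ∧
      ‖fderiv ℝ (fderiv ℝ (shiftQ (S i))) x‖ ≤ C * μ i ∧
      (μ i ≤ η → ‖fderiv ℝ (shiftP (S i)) x‖ ≤ 1 / 2 ∧ ‖fderiv ℝ (shiftQ (S i)) x‖ ≤ 1 / 2) := by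
  obtain ⟨C₁, hC₁⟩ := (smoothBigO_shiftP hS).norm_le
  obtain ⟨C₂, hC₂⟩ := (smoothBigO_shiftP hS).norm_fderiv_le
  obtain ⟨C₃, hC₃⟩ := (smoothBigO_shiftQ hS).norm_fderiv_le
  obtain ⟨C₄, hC₄⟩ := (smoothBigO_shiftQ hS).fderiv_right.norm_fderiv_le
  let η : ℝ := 1 / (2 * (1 + C₂ + C₃))
  have hη : (1 + C₂ + C₃) * η = 1 / 2 := by simp only [η]; field_simp
  have hη0 : 0 < η := by positivity
  have hsmall : ∀ {C : ℝ≥0} {m : ℝ}, (C : ℝ) ≤ 1 + C₂ + C₃ → m ≤ η → C * m ≤ 1 / 2 :=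
    fun {C m} hC hm => (mul_le_mul_of_nonneg_left hm C.2).trans
      ((mul_le_mul_of_nonneg_right hC hη0.le).trans_eq hη)
  refine ⟨C₁ + C₄, η, by positivity, hη0, fun i x => ⟨(hC₁ i x).trans ?_, (hC₄ i x).trans ?_,
    fun hi => ⟨(hC₂ i x).trans (hsmall ?_ hi), (hC₃ i x).trans (hsmall ?_ hi)⟩⟩⟩
  · gcongr
    exact le_add_of_nonneg_right C₄.2
  · gcongr
    exact le_add_of_nonneg_left C₁.2
  · linarith [C₃.2]
  · linarith [C₂.2]

lemma exists_normal_form_of_scaling (hV : ContDiff ℝ ∞ V) (hVp : AnglePeriodic V)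
    (hVb : BoundedDerivs V) {ι : Type*} {r : ι → ℝ} {μ : ι → ℝ≥0} (hr0 : ∀ i, 0 < r i)
    (hr1 : ∀ i, r i ≤ 1) (hμ : μ ≤ 1) (K : ι → ℕ) (n N : ℕ) :
    ∃ C η : ℝ, 0 ≤ C ∧ 0 < η ∧ ∀ i, μ i ≤ η → ∃ (T : Phase d → Phase d) (Z : Phase d → ℝ),
      IsCanonical T ∧ ContDiff ℝ ∞ Z ∧ IsResonantTrigPoly (K i) (r i) Z ∧
      (∃ B, ∀ x, ‖iteratedFDeriv ℝ 2 Z x‖ ≤ B) ∧ (∀ x, ‖(T x).1 - x.1‖ ≤ C * (r i * μ i)) ∧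
      C2NormLE (fun x => perturbedH (r i ^ 2 * μ i) V (T x) - (freeH x + Z x))
        (C * ((μ i : ℝ) ^ n + ((1 + (K i : ℝ)) ^ N)⁻¹)) := by
  have hW := smoothBigO_comp_scale hV hVb fun i => (abs_of_pos (hr0 i)).trans_le (hr1 i)
  obtain ⟨S, Z, hS, hZ, hSp, hE, hres⟩ :=
    exists_hj_solution hμ hW (fun i => isAnglePeriodic_comp_scale hVp (r i)) K n N
  obtain ⟨C₁, η, hC₁, hη, hbounds⟩ := exists_shift_bounds hS
  obtain ⟨C₂, hC₂⟩ := hE.exists_forall_le 2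
  obtain ⟨C₃, hC₃⟩ := hZ.bound 2
  refine ⟨C₁ + 2 * (2 + 8 * C₁) ^ 2 * C₂, η, by positivity, hη, fun i hi => ?_⟩
  obtain ⟨T, hT, hTmove, hTdefect⟩ := exists_canonical_of_hjDefect (hr0 i) (hr1 i) (hS.smooth i)
    (hSp i) (hE.smooth i) (fun x => ((hbounds i x).2.2 hi).1) (fun x => ((hbounds i x).2.2 hi).2)
    (fun x => (hbounds i x).1)
    (fun x => (hbounds i x).2.1.trans (mul_le_of_le_one_right hC₁ (by exact_mod_cast hμ i)))
    (fun n hn x => hC₂ n hn i x)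
  refine ⟨T, fun x => r i ^ 2 • Z i (scale (r i)⁻¹ x), hT,
    ((hZ.smooth i).comp (scale (r i)⁻¹).contDiff).const_smul (r i ^ 2),
    (hres i).conj_scale (hr0 i), ⟨C₃ * μ i, norm_iteratedFDeriv_sq_smul_comp_scale_inv_le
      (hZ.smooth i) (hr0 i) (hr1 i) le_rfl (hC₃ i)⟩, fun x => (hTmove x).trans ?_,
    fun n hn x => (hTdefect n hn x).trans ?_⟩
  · rw [mul_left_comm]
    have := (hr0 i).le
    gcongr
    exact le_add_of_nonneg_right (by positivity)
  · push_cast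
    rw [← mul_assoc]
    gcongr
    exact le_add_of_nonneg_left hC₁

lemma one_le_cutoff (β ε : ℝ) : 1 ≤ cutoff β ε := Nat.le_add_left 1 _

lemma rpow_pow_le_rpow {s ε M : ℝ} (h0 : 0 < ε) (h1 : ε ≤ 1) {N : ℕ} (hN : M ≤ s * N) :
    (ε ^ s) ^ N ≤ ε ^ M := by
  rw [← Real.rpow_mul_natCast h0.le]
  exact Real.rpow_le_rpow_of_exponent_ge h0 h1 hN

lemma inv_one_add_cutoff_pow_le {β ε M : ℝ} (h0 : 0 < ε) (h1 : ε ≤ 1) {N : ℕ} (hN : M ≤ β * N) :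
    ((1 + (cutoff β ε : ℝ)) ^ N)⁻¹ ≤ ε ^ M := by
  have : 0 < ε ^ β := Real.rpow_pos_of_pos h0 β
  have hcutoff : 1 / ε ^ β ≤ cutoff β ε := by
    rw [cutoff, Nat.cast_add, Nat.cast_one]
    exact (Nat.lt_floor_add_one _).le
  calc ((1 + (cutoff β ε : ℝ)) ^ N)⁻¹ ≤ ((1 / ε ^ β) ^ N)⁻¹ := by
        gcongr
        linarith
    _ = (ε ^ β) ^ N := by rw [one_div, inv_pow, inv_inv]
    _ ≤ ε ^ M := rpow_pow_le_rpow h0 h1 hN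

lemma IsResonantTrigPoly.isNormalForm {δ β ε : ℝ} {Z : Phase d → ℝ}
    (hZ : IsResonantTrigPoly (cutoff β ε) (ε ^ δ) Z) : IsNormalForm δ β ε Z :=
  let ⟨c, hc, hres⟩ := hZ
  ⟨c, hc, fun k _ _ => hres k⟩

lemma sq_rpow_mul_rpow {ε : ℝ} (h0 : 0 < ε) (δ : ℝ) : (ε ^ δ) ^ 2 * ε ^ (1 - 2 * δ) = ε := by
  rw [← Real.rpow_mul_natCast h0.le, ← Real.rpow_add h0, Nat.cast_two, mul_comm δ,
    add_sub_cancel, Real.rpow_one]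

lemma rpow_mul_rpow_one_sub {ε : ℝ} (h0 : 0 < ε) (δ : ℝ) :
    ε ^ δ * ε ^ (1 - 2 * δ) = ε ^ (1 - δ) := by
  rw [← Real.rpow_add h0]
  ring_nf

-- Scaling the actions by `ε ^ δ` leaves a perturbation of size `ε ^ (1 - 2 * δ)`.
lemma exists_normal_form (hV : ContDiff ℝ ∞ V) (hVp : AnglePeriodic V) (hVb : BoundedDerivs V)
    {δ β : ℝ} (hδ0 : 0 ≤ δ) (hδ : δ < 1 / 2) (hβ : 0 < β) (M : ℝ) :
    ∃ C ε₀ : ℝ, 0 ≤ C ∧ 0 < ε₀ ∧ ε₀ ≤ 1 ∧ ∀ ε : ℝ, 0 < ε → ε < ε₀ →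
      ∃ (T : Phase d → Phase d) (Z : Phase d → ℝ), IsCanonical T ∧ ContDiff ℝ ∞ Z ∧
        IsNormalForm δ β ε Z ∧ (∃ B, ∀ x, ‖iteratedFDeriv ℝ 2 Z x‖ ≤ B) ∧
        (∀ x, ‖(T x).1 - x.1‖ ≤ C * ε ^ (1 - δ)) ∧
        C2NormLE (fun x => perturbedH ε V (T x) - (freeH x + Z x)) (C * ε ^ M) := by
  have hs : 0 < 1 - 2 * δ := by linarith
  obtain ⟨n, hn⟩ := exists_nat_ge (M / (1 - 2 * δ))
  obtain ⟨N, hN⟩ := exists_nat_ge (M / β)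
  rw [div_le_iff₀' hs] at hn
  rw [div_le_iff₀' hβ] at hN
  let μ : Set.Ioo (0 : ℝ) 1 → ℝ≥0 := fun ε => ⟨ε.1 ^ (1 - 2 * δ), Real.rpow_nonneg ε.2.1.le _⟩
  obtain ⟨C, η, hC, hη, h⟩ := exists_normal_form_of_scaling hV hVp hVb
    (r := fun ε : Set.Ioo (0 : ℝ) 1 => ε.1 ^ δ) (μ := μ) (fun ε => Real.rpow_pos_of_pos ε.2.1 δ)
    (fun ε => Real.rpow_le_one ε.2.1.le ε.2.2.le hδ0)
    (fun ε => Real.rpow_le_one ε.2.1.le ε.2.2.le hs.le) (fun ε => cutoff β ε) n N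
  refine ⟨C * 2, min 1 (η ^ (1 - 2 * δ)⁻¹), by positivity,
    lt_min one_pos (Real.rpow_pos_of_pos hη _), min_le_left _ _, fun ε h0 hε => ?_⟩
  have h1 : ε < 1 := hε.trans_le (min_le_left _ _)
  have hμη : ε ^ (1 - 2 * δ) ≤ η :=
    (Real.le_rpow_inv_iff_of_pos h0.le hη.le hs).1 (hε.le.trans (min_le_right _ _))
  obtain ⟨T, Z, hT, hZ, hres, hB, hmove, hdefect⟩ := h ⟨ε, h0, h1⟩ hμη
  change ∀ x, ‖(T x).1 - x.1‖ ≤ C * (ε ^ δ * ε ^ (1 - 2 * δ)) at hmove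
  change C2NormLE (fun x => perturbedH ((ε ^ δ) ^ 2 * ε ^ (1 - 2 * δ)) V (T x) - (freeH x + Z x))
    (C * ((ε ^ (1 - 2 * δ)) ^ n + ((1 + (cutoff β ε : ℝ)) ^ N)⁻¹)) at hdefect
  rw [rpow_mul_rpow_one_sub h0] at hmove
  rw [sq_rpow_mul_rpow h0] at hdefect
  refine ⟨T, Z, hT, hZ, hres.isNormalForm, hB, fun x => (hmove x).trans ?_,
    fun m hm x => (hdefect m hm x).trans ?_⟩
  · have := Real.rpow_nonneg h0.le (1 - δ)
    gcongr
    linarith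
  · rw [mul_assoc C 2]
    gcongr
    linarith [rpow_pow_le_rpow h0 h1.le hn, inv_one_add_cutoff_pow_le h0 h1.le hN]

lemma cutoff_pow_mul_rpow_le {δ β b ε : ℝ} (hβ : 0 ≤ β) {a : ℕ} (hb : b ≤ δ - β * a) (h0 : 0 < ε)
    (h1 : ε ≤ 1) : (cutoff β ε : ℝ) ^ a * ε ^ δ ≤ 2 ^ a * ε ^ b := by
  have hcutoff : (cutoff β ε : ℝ) ≤ 2 * ε ^ (-β) := by
    have hone : 1 ≤ ε ^ (-β) := Real.one_le_rpow_of_pos_of_le_one_of_nonpos h0 h1 (by linarith)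
    have hfloor := Nat.floor_le (zero_le_one.trans hone)
    rw [cutoff, Nat.cast_add, Nat.cast_one, one_div, ← Real.rpow_neg h0.le]
    linarith
  calc (cutoff β ε : ℝ) ^ a * ε ^ δ ≤ (2 * ε ^ (-β)) ^ a * ε ^ δ := by gcongr
    _ = 2 ^ a * ε ^ (δ - β * a) := by
        rw [mul_pow, ← Real.rpow_mul_natCast h0.le, sub_eq_add_neg, Real.rpow_add h0]
        ring_nf
    _ ≤ 2 ^ a * ε ^ b :=
        mul_le_mul_of_nonneg_left (Real.rpow_le_rpow_of_exponent_ge h0 h1 hb) (by positivity)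

lemma exists_normalForm_drift_bound (d : ℕ) : ∃ a : ℕ, ∃ D : ℝ, 0 < D ∧
    ∀ {δ β b : ℝ}, 0 ≤ β → b ≤ δ - β * a → ∀ {ε : ℝ}, 0 < ε → ε ≤ 1 → ∀ {Z : Phase d → ℝ},
      Differentiable ℝ Z → IsNormalForm δ β ε Z →
      ∀ γ : ℝ → Phase d, IsSolution (fun x => freeH x + Z x) γ →
        ∀ t, ‖(γ t).1 - (γ 0).1‖ ≤ D * ε ^ b := by
  obtain ⟨D, hD0, hD⟩ := exists_drift_bound d
  refine ⟨(2 * d + 2) * d, D * 2 ^ ((2 * d + 2) * d), by positivity,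
    fun {δ β b} hβ hb {ε} h0 h1 {Z} hZ hn γ hγ t => ?_⟩
  have hfst : ∀ t, HasDerivAt (fun t => (γ t).1) (-gradQ (fderiv ℝ Z (γ t))) t := fun t => by
    have hderiv := hγ t
    rw [hamField_freeH_add (hZ _)] at hderiv
    exact (ContinuousLinearMap.fst ℝ (Vec d) (Vec d)).hasFDerivAt.comp_hasDerivAt t hderiv
  refine (hD (cutoff β ε) (one_le_cutoff β ε) (ε ^ δ) (Real.rpow_pos_of_pos h0 δ) _ _ hfst
    (fun t => neg_mem (hn.gradQ_mem_resonantSpan (hZ _))) t).trans ?_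
  rw [mul_assoc, mul_assoc]
  exact mul_le_mul_of_nonneg_left (cutoff_pow_mul_rpow_le hβ hb h0 h1) hD0.le

lemma exists_exponents {b : ℝ} (hb : b < 1 / 2) (a : ℕ) :
    ∃ δ β : ℝ, b < δ ∧ δ < 1 / 2 ∧ 0 < β ∧ β < 1 ∧ b ≤ δ - β * a := by
  obtain ⟨δ, hbδ, hδ⟩ := exists_between hb
  have hβ := min_le_right (1 / 2) ((δ - b) / (a + 1))
  have hβ0 : 0 < min (1 / 2) ((δ - b) / (a + 1)) :=
    lt_min one_half_pos (div_pos (sub_pos.2 hbδ) (by positivity))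
  rw [le_div_iff₀ (by positivity)] at hβ
  exact ⟨δ, min (1 / 2) ((δ - b) / (a + 1)), hbδ, hδ, hβ0,
    (min_le_left _ _).trans_lt one_half_lt_one, by linarith⟩

end NormalForm

end Nekhoroshev

end

open Nekhoroshev in
theorem theorem1p2 (d : ℕ) (b : ℝ) (hb0 : 0 < b) (hb : b < 1 / 2) :
    ∃ δ β : ℝ, 0 < δ ∧ δ < 1 / 2 ∧ 0 < β ∧ β < 1 ∧
      ∀ V : Nekhoroshev.Phase d → ℝ, ContDiff ℝ ∞ V → Nekhoroshev.AnglePeriodic V →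
        Nekhoroshev.BoundedDerivs V →
      ∀ M : ℝ, 0 < M → ∃ C ε₀ : ℝ, 0 < C ∧ 0 < ε₀ ∧
        ∀ ε : ℝ, 0 < ε → ε < ε₀ →
          ∃ (T : Nekhoroshev.Phase d → Nekhoroshev.Phase d) (Z HZ : Nekhoroshev.Phase d → ℝ),
            Nekhoroshev.IsCanonical T ∧
            ContDiff ℝ ∞ Z ∧ Nekhoroshev.IsNormalForm δ β ε Z ∧
            (∀ x, HZ x = Nekhoroshev.freeH x + Z x) ∧
            (∀ x, ‖(T x).1 - x.1‖ ≤ C * ε ^ b) ∧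
            Nekhoroshev.C2NormLE
              (fun x => Nekhoroshev.perturbedH ε V (T x) - HZ x) (C * ε ^ M) ∧
            (∀ x₀, ∃ γ : ℝ → Nekhoroshev.Phase d, γ 0 = x₀ ∧ Nekhoroshev.IsSolution HZ γ) ∧
            (∀ γ : ℝ → Nekhoroshev.Phase d, Nekhoroshev.IsSolution HZ γ →
              ∀ t : ℝ, ‖(γ t).1 - (γ 0).1‖ ≤ C * ε ^ b) := by
  obtain ⟨a, D, hD0, hD⟩ := exists_normalForm_drift_bound d
  obtain ⟨δ, β, hbδ, hδ, hβ0, hβ1, hba⟩ := exists_exponents hb a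
  refine ⟨δ, β, hb0.trans hbδ, hδ, hβ0, hβ1, fun V hV hVp hVb M _ => ?_⟩
  obtain ⟨C, ε₀, hC0, hε₀, hε₀1, h⟩ :=
    exists_normal_form hV hVp hVb (hb0.trans hbδ).le hδ hβ0 M
  refine ⟨C + D, ε₀, by positivity, hε₀, fun ε h0 hε => ?_⟩
  obtain ⟨T, Z, hT, hZ, hn, ⟨B, hB⟩, hmove, hdefect⟩ := h ε h0 hε
  have h1 : ε ≤ 1 := hε.le.trans hε₀1
  have hεδ : ε ^ (1 - δ) ≤ ε ^ b := Real.rpow_le_rpow_of_exponent_ge h0 h1 (by linarith)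
  refine ⟨T, Z, fun x => freeH x + Z x, hT, hZ, hn, fun _ => rfl, fun x => (hmove x).trans ?_,
    fun n hn x => (hdefect n hn x).trans ?_, exists_solution hZ hB, fun γ hγ t =>
      (hD hβ0.le hba h0 h1 (hZ.differentiable (by simp)) hn γ hγ t).trans ?_⟩ <;> gcongr <;>
    linarith
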